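/- Let $\mathbf{k}$ be a field of characteristic $p>0$ and let $\Lambda$ be a finite dimensional symmetric $\mathbf{k}$-algebra, i.e. $\Lambda$ has a nondegenerate bilinear form $(\,,)$ with $(ab,c)=(a,bc)$ and $(a,b)=(b,a)$. Write $Z(\Lambda)$ for the center, $[\Lambda,\Lambda]$ for the linear span of all $ab-ba$, and put, for $r\ge 0$, $$K_r\Lambda=\{a\in Z(\Lambda)\mid ab\in[\Lambda,\Lambda]\text{ for all }b\in\Lambda\text{ with }b^{p^r}\in[\Lambda,\Lambda]\},\qquad R\Lambda=\bigcap_{r\ge0}K_r\Lambda,$$ $$K_r^{cl}\Lambda=\{a\in\Lambda\mid (a,b)=0\text{ for all }b\in\Lambda\text{ with }b^{p^r}\in[\Lambda,\Lambda]\}.$$ Let $K^b_p\Lambda$ be the homotopy category of bounded complexes of finitely generated projective right $\Lambda$-modules, with shift $[1]$, and let $A=K^b_p\Lambda/[1]$ be its orbit category: the graded category with the same objects, with $\mathrm{Hom}_A(x,y)_n=\mathrm{Hom}(x,y[n])$ for $n\in\mathbb{Z}$, and with composition $g\circ f=g[n]f$ for $f$ of degree $n$. Its graded center $Z^*$ has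 as its degree $n$ part the families $(\eta_x)_x$, $\eta_x\in\mathrm{Hom}_A(x,x)_n$, with $f\eta_x=(-1)^{nj}\eta_yf$ for all $f\in\mathrm{Hom}_A(x,y)_j$. Let $[A,A]\subseteq\bigoplus_x\mathrm{Hom}_A(x,x)$ be the span of all $fg-(-1)^{ij}gf$ with $f\in\mathrm{Hom}_A(y,x)_i$, $g\in\mathrm{Hom}_A(x,y)_j$. Let $T_r$ be the graded subspace of the quotient $\bigoplus_x\mathrm{Hom}_A(x,x)/[A,A]$ whose degree $n$ part consists of the classes of the degree $n$ elements $f$ with $f^{p^r}\in[A,A]$ (powers are taken componentwise). Let $K_r(A)\subseteq Z^*$ be the two-sided annihilator of $T_r$, and let $R(A)=\bigcap_{r\ge0}K_r(A)$. Let $\chi\colon HH^0(\Lambda)=Z(\Lambda)\to Z^0$ be the degree $0$ part of the characteristic homomorphism, which sends $a$ to multiplication by $a$ on every complex, and put $HK_r^0(\Lambda)=\chi^{-1}(K_r(A))$ and $HR^0(\Lambda)=\chi^{-1}(R(A))$. Then $HK_r^0(\Lambda)=K_r\Lambda=K_r^{cl}\Lambda$ for all $r\ge0$. In particular, $HR^0(\Lambda)=R\Lambda$,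 and this ideal is $Z(\Lambda)\cap\mathrm{soc}(\Lambda)$, the part of the socle of $\Lambda$ that lies in the center (where $\mathrm{soc}(\Lambda)$ may be taken as the left or as the right socle). -/

import Mathlib

open CategoryTheory

namespace Kuelshammer

universe u v w

/-! ### The graded orbit category of a linear category with a shift

For a `k`-linear category `C` with shift functors `⟦n⟧` (`n : ℤ`), the orbit category `C/[1]` has
the objects of `C`, its morphisms `x ⟶ y` of degree `n` are the elements of
`ShiftedHom x y n = (x ⟶ y⟦n⟧)`, and the composite "first `f`, then `g`" of `f` of degree `i` and
`g` of degree `j` is `f.comp g : ShiftedHom x z (j + i)`, that is `g⟦i⟧ ∘ f`. -/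

section OrbitCategory

variable (k : Type u) [Field k] (C : Type v) [Category.{w} C] [Preadditive C] [Linear k C]
  [HasShift C ℤ] [∀ n : ℤ, (shiftFunctor C n).Additive]

/-- The degree `n` part of `⨁ x, Hom_{C/[1]}(x, x)`. -/
abbrev Loops (n : ℤ) : Type (max v w) := DirectSum C (fun x => ShiftedHom x x n)

open Classical in
/-- The degree `n` part of the graded commutator subspace `[A, A]` for `A = C/[1]`: the subspace of
`⨁ x, Hom_A(x, x)` spanned by all `g f - (-1) ^ (i j) f g`, for `f : x ⟶ y` of degree `i` and
`g : y ⟶ x` of degree `j` with `i + j = n`. The degree `n` part of the abelianization of `A` is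
`Loops C n ⧸ commutators k C n`. -/
noncomputable def commutators (n : ℤ) : Submodule k (Loops C n) :=
  Submodule.span k {c | ∃ (x y : C) (i j : ℤ) (hij : j + i = n) (hji : i + j = n)
    (f : ShiftedHom x y i) (g : ShiftedHom y x j),
    c = DirectSum.of (fun z : C => ShiftedHom z z n) x (f.comp g hij) -
      (i * j).negOnePow • DirectSum.of (fun z : C => ShiftedHom z z n) y (g.comp f hji)}

variable {C}

/-- The `m`-th power, in the orbit category, of an endomorphism of degree `n`. -/
noncomputable def endPow {x : C} {n : ℤ} (f : ShiftedHom x x n) :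
    (m : ℕ) → ShiftedHom x x ((m : ℤ) * n)
  | 0 => ShiftedHom.mk₀ _ (by simp) (𝟙 x)
  | m + 1 => f.comp (endPow f m) (by push_cast; ring)

set_option linter.unusedSectionVars false in
lemma endPow_zero (x : C) (n : ℤ) (m : ℕ) [NeZero m] :
    endPow (0 : ShiftedHom x x n) m = 0 := by
  obtain ⟨l, rfl⟩ := Nat.exists_eq_succ_of_ne_zero (NeZero.ne m)
  exact ShiftedHom.zero_comp _ _ _ _

variable (C) in
/-- The map `f ↦ f ^ m` on the degree `n` part of the algebra `⨁ x, Hom(x, x)` (whose product is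
computed componentwise), for `m ≠ 0`. -/
noncomputable def loopPow (m : ℕ) [NeZero m] {n : ℤ} (f : Loops C n) : Loops C ((m : ℤ) * n) :=
  DFinsupp.mapRange (fun _ g => endPow g m) (fun x => endPow_zero x n m) f

/-- The product `η f` (first `f`, then `η`) of a family `η` of endomorphisms of degree `n` with an
element `f` of degree `m` of `⨁ x, Hom(x, x)`. -/
noncomputable def leftMul {n m s : ℤ} (h : n + m = s) (η : ∀ x : C, ShiftedHom x x n)
    (f : Loops C m) : Loops C s :=
  DFinsupp.mapRange (fun x g => ShiftedHom.comp g (η x) h)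
    (fun _ => ShiftedHom.zero_comp _ _ _ _) f

/-- The product `f η` (first `η`, then `f`). -/
noncomputable def rightMul {n m s : ℤ} (h : m + n = s) (η : ∀ x : C, ShiftedHom x x n)
    (f : Loops C m) : Loops C s :=
  DFinsupp.mapRange (fun x g => ShiftedHom.comp (η x) g h)
    (fun _ => ShiftedHom.comp_zero _ _ _) f

variable (C) in
/-- The degree `n` part of the graded center of `C`, that is of the center of the graded category
`C/[1]`: the families `η` of endomorphisms of degree `n` with
`f η_x = (-1) ^ (n j) η_y f` for all `f : x ⟶ y` of degree `j`. -/
def gradedCenter (n : ℤ) : Set (∀ x : C, ShiftedHom x x n) :=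
  {η | ∀ (x y : C) (j : ℤ) (f : ShiftedHom x y j),
    (η x).comp f rfl = (n * j).negOnePow • f.comp (η y) (add_comm n j)}

variable (C)

/-- The elements `f` of degree `n` of `⨁ x, Hom(x, x)` with `f ^ (p ^ r) ∈ [A, A]`. Their classes in
the abelianization of `A = C/[1]` form the degree `n` part of `T_r A`, the kernel of the `r`-th
iterate of the map that is induced by `f ↦ f ^ p` on the abelianization. -/
def kernelPow (p : ℕ) [NeZero p] (r : ℕ) (n : ℤ) : Set (Loops C n) :=
  {f | loopPow C (p ^ r) f ∈ commutators k C (((p ^ r : ℕ) : ℤ) * n)}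

/-- The degree `n` part of the `(r, s)`-th Külshammer ideal `K_{r,s} A` of `A = C/[1]`: the central
elements of degree `n` that annihilate, from both sides, the part of degree `s - n` of `T_r A` in
the abelianization of `A`. -/
def kuelshammerRS (p : ℕ) [NeZero p] (r : ℕ) (s n : ℤ) : Set (∀ x : C, ShiftedHom x x n) :=
  {η | η ∈ gradedCenter C n ∧ ∀ f ∈ kernelPow k C p r (s - n),
    leftMul (add_sub_cancel n s) η f ∈ commutators k C s ∧
      rightMul (sub_add_cancel s n) η f ∈ commutators k C s}

/-- The degree `n` part of the `r`-th Külshammer ideal `K_r A = ⋂ s, K_{r,s} A` of `A = C/[1]`. -/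
def kuelshammerIdeal (p : ℕ) [NeZero p] (r : ℕ) (n : ℤ) : Set (∀ x : C, ShiftedHom x x n) :=
  ⋂ s : ℤ, kuelshammerRS k C p r s n

/-- The degree `n` part of the Reynolds ideal `R A = ⋂ r, K_r A` of `A = C/[1]`. -/
def reynoldsIdeal (p : ℕ) [NeZero p] (n : ℤ) : Set (∀ x : C, ShiftedHom x x n) :=
  ⋂ r : ℕ, kuelshammerIdeal k C p r n

end OrbitCategory

/-! ### The category of perfect complexes and the characteristic homomorphism in degree zero -/

section Perfect

variable (Γ : Type v) [Ring Γ]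

/-- Bounded complexes of finitely generated projective `Γ`-modules. -/
def isPerfectComplex : ObjectProperty (CochainComplex (ModuleCat.{v} Γ) ℤ) :=
  fun K => (∃ a b : ℤ, ∀ i : ℤ, i < a ∨ b < i → Subsingleton (K.X i)) ∧
    ∀ i : ℤ, Module.Finite Γ (K.X i) ∧ Module.Projective Γ (K.X i)

/-- Bounded complexes of finitely generated projective `Γ`-modules, as objects of the homotopy
category of complexes of `Γ`-modules. -/
def isPerfect : ObjectProperty (HomotopyCategory (ModuleCat.{v} Γ) (ComplexShape.up ℤ)) :=
  (isPerfectComplex Γ).strictMap (HomotopyCategory.quotient _ _)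

instance : (isPerfect Γ).IsStableUnderShift ℤ where
  isStableUnderShiftBy n :=
    { le_shift := by
        rintro _ ⟨K, ⟨⟨a, b, hab⟩, hfp⟩⟩
        rw [ObjectProperty.prop_shift_iff, HomotopyCategory.shift_quotient_obj]
        exact ⟨K⟦n⟧, ⟨⟨a - n, b - n, fun i hi => hab (i + n) (by omega)⟩,
          fun i => hfp (i + n)⟩⟩ }

/-- The homotopy category `K^b_p` of bounded complexes of finitely generated projective
`Γ`-modules. -/
abbrev PerfectCat : Type (v + 1) := (isPerfect Γ).FullSubcategory

end Perfect

section Algebra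

variable (k : Type u) [Field k] (Λ : Type v) [Ring Λ] [Algebra k Λ]

variable {k Λ} in
/-- Multiplication by a central element `a` of `Λ` on a right `Λ`-module. -/
def centerMul (a : Subalgebra.center k Λ) (M : ModuleCat.{v} Λᵐᵒᵖ) : M ⟶ M :=
  ModuleCat.ofHom
    { toFun := fun x => MulOpposite.op (a : Λ) • x
      map_add' := fun x y => smul_add _ x y
      map_smul' := fun b x => by
        have h : MulOpposite.op (a : Λ) * b = b * MulOpposite.op (a : Λ) :=
          MulOpposite.unop_injective (by
            simpa using Subalgebra.mem_center_iff.mp a.2 b.unop)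
        simp only [RingHom.id_apply, smul_smul, h] }

variable {k Λ} in
/-- Multiplication by a central element of `Λ` on a complex of right `Λ`-modules. -/
def centerMulComplex (a : Subalgebra.center k Λ)
    (K : CochainComplex (ModuleCat.{v} Λᵐᵒᵖ) ℤ) : K ⟶ K where
  f i := centerMul a (K.X i)
  comm' i j _ := by
    ext x
    exact (K.d i j).hom.map_smul (MulOpposite.op (a : Λ)) x

variable {k Λ} in
/-- Multiplication by a central element of `Λ`, as an endomorphism of an object of the homotopy
category of complexes of right `Λ`-modules. -/
def centerMulHomotopy (a : Subalgebra.center k Λ)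
    (X : HomotopyCategory (ModuleCat.{v} Λᵐᵒᵖ) (ComplexShape.up ℤ)) : X ⟶ X :=
  (HomotopyCategory.quotient _ _).map (centerMulComplex a X.as)

variable {k Λ} in
/-- The characteristic homomorphism in degree `0`, from `HH^0(Λ) = Z(Λ)` to the graded center of
the category `K^b_p` of right `Λ`-modules: the class of `a ∈ Z(Λ)`, seen as an endomorphism of the
bimodule `Λ`, is sent to the family `Id_X ⊗_Λ a : X ≅ X ⊗_Λ Λ ⟶ X ⊗_Λ Λ ≅ X`, that is to
multiplication by `a` on every `X`. -/
noncomputable def characteristicZero (a : Subalgebra.center k Λ) (X : PerfectCat Λᵐᵒᵖ) :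
    ShiftedHom X X (0 : ℤ) :=
  ShiftedHom.mk₀ 0 rfl (ObjectProperty.homMk (centerMulHomotopy a X.obj))

/-- The degree zero part `HK_r^0(Λ) ⊆ HH^0(Λ) = Z(Λ)` of the `r`-th higher Külshammer ideal: the
inverse image of `K_r(K^b_p Λ / [1])` under the characteristic homomorphism. -/
def HK0 (p : ℕ) [NeZero p] (r : ℕ) : Set Λ :=
  {a | ∃ ha : a ∈ Subalgebra.center k Λ,
    characteristicZero ⟨a, ha⟩ ∈ kuelshammerIdeal k (PerfectCat Λᵐᵒᵖ) p r 0}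

/-- The degree zero part `HR^0(Λ) ⊆ HH^0(Λ) = Z(Λ)` of the higher Reynolds ideal: the
inverse image of `R(K^b_p Λ / [1])` under the characteristic homomorphism. -/
def HR0 (p : ℕ) [NeZero p] : Set Λ :=
  {a | ∃ ha : a ∈ Subalgebra.center k Λ,
    characteristicZero ⟨a, ha⟩ ∈ reynoldsIdeal k (PerfectCat Λᵐᵒᵖ) p 0}

/-! ### Külshammer ideals, the Reynolds ideal and the socle of an algebra -/

/-- The commutator subspace `[Λ, Λ]`, spanned by all `a b - b a`. -/
def commutatorSpace : Submodule k Λ :=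
  Submodule.span k {c | ∃ a b : Λ, c = a * b - b * a}

/-- The `r`-th Külshammer ideal `K_r Λ`. -/
def idealK (p r : ℕ) : Set Λ :=
  {a | a ∈ Subalgebra.center k Λ ∧
    ∀ b : Λ, b ^ p ^ r ∈ commutatorSpace k Λ → a * b ∈ commutatorSpace k Λ}

/-- The Reynolds ideal `R Λ = ⋂ r, K_r Λ`. -/
def idealR (p : ℕ) : Set Λ := ⋂ r : ℕ, idealK k Λ p r

variable {k Λ} in
/-- A symmetrizing form on `Λ`: a nondegenerate bilinear form with `(a b, c) = (a, b c)` and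
`(a, b) = (b, a)`. -/
structure IsSymmetrizingForm (B : LinearMap.BilinForm k Λ) : Prop where
  nondegenerate : B.Nondegenerate
  assoc : ∀ a b c : Λ, B (a * b) c = B a (b * c)
  symm : ∀ a b : Λ, B a b = B b a

variable {k Λ} in
/-- The `r`-th classical Külshammer ideal, defined by a symmetrizing form. -/
def idealKcl (B : LinearMap.BilinForm k Λ) (p r : ℕ) : Set Λ :=
  {a | ∀ b : Λ, b ^ p ^ r ∈ commutatorSpace k Λ → B a b = 0}

/-- The socle of a module: the sum of its simple submodules. -/
def socle (A M : Type*) [Ring A] [AddCommGroup M] [Module A M] : Submodule A M :=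
  sSup {N : Submodule A M | IsSimpleModule A N}

end Algebra

end Kuelshammer

namespace Kuelshammer

universe u v w

/-! ### Tracial maps are additive on p-th powers in characteristic p -/

section Tracial

variable {R W : Type*} [Ring R] [AddCommGroup W]

/-! Inside Λ, write T_r for the set of b with b^(p^r) in [Λ,Λ]. For a symmetrizing form, Z(Λ) and
[Λ,Λ] are orthogonal complements of each other, so K_r and K_r^cl agree by formal manipulations
(`idealK_eq_idealKcl`). For the Reynolds ideal, T_r lies in [Λ,Λ] + J with J the radical
(`exists_sub_mem_jacobson_of_pow_mem`), while each nilpotent element lies in T_r for large r; hence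
RΛ is the annihilator of J in the center, which is the central part of the socle. The inclusion of
T_r comes down to simple algebras, and after extension of scalars to matrices, where tr(M^p) =
tr(M)^p.

On perfect complexes, the alternating sum of Hattori-Stallings traces takes values in the commutator
quotient, is homotopy invariant, picks up (-1)^n under [n] and turns p-th powers into the Frobenius
map of that quotient. Composed with the form it gives a nondegenerate pairing of Hom(x,y) with
Hom(y,x) (`nonempty_homotopy_zero_of_traceForm_strace_eq_zero`). So every functional on a graded
piece of A/[A,A] is f ↦ tr(fη) for some η in the graded center (`exists_gradedCenter_eq_deg_comp`).

Let a ∈ K_rΛ and let f represent a class of T_r. The loop fη has degree 0 and (fη)^(p^r) =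
±f^(p^r)η^(p^r) has trace zero, so the trace of fη is the class of some b ∈ T_r of the algebra.
Since ab is a commutator, every functional vanishes on af, that is af ∈ [A,A]
(`leftMul_mem_commutators`). The converse inclusion is tested on the regular module, where the
supertrace recovers the class of b itself. -/

lemma tracial_coeff_mul_comm (τ : R →+ W) (hτ : ∀ a b, τ (a * b) = τ (b * a))
    (f g : Polynomial R) (n : ℕ) : τ ((f * g).coeff n) = τ ((g * f).coeff n) := by
  rw [Polynomial.coeff_mul, Polynomial.coeff_mul, map_sum, map_sum,
    ← Finset.Nat.sum_antidiagonal_swap]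
  exact Finset.sum_congr rfl fun _ _ => hτ _ _

/-- By Leibniz, (f^m)' is a sum of m terms f^i f' f^(m-1-i), and cyclicity identifies their traces.
The spare factor f^l carries the powers moved aside during the induction. For m = 0 both sides
vanish, so the truncated subtraction does no harm. -/
lemma tracial_coeff_derivative_pow_mul (τ : R →+ W) (hτ : ∀ a b, τ (a * b) = τ (b * a))
    (f : Polynomial R) (n m l : ℕ) :
    τ ((Polynomial.derivative (f ^ m) * f ^ l).coeff n) =
      m • τ ((f ^ (m + l - 1) * Polynomial.derivative f).coeff n) := by
  induction m generalizing l with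
  | zero => simp
  | succ m ih =>
    have h1 : τ ((f ^ m * Polynomial.derivative f * f ^ l).coeff n) =
        τ ((f ^ (m + l) * Polynomial.derivative f).coeff n) := by
      rw [tracial_coeff_mul_comm τ hτ, ← mul_assoc, ← pow_add, add_comm l]
    rw [pow_succ, Polynomial.derivative_mul, add_mul, Polynomial.coeff_add, map_add, mul_assoc,
      ← pow_succ', ih, h1, succ_nsmul]
    rw [show m + (l + 1) - 1 = m + l by omega, show m + 1 + l - 1 = m + l by omega]

/-- Expand (aX + b)^p. Its derivative has coefficients of trace p·(...) = 0, so for 0 < n < p the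
trace of the n-th coefficient is killed by n and by p, hence is zero. The extreme coefficients are
b^p and a^p, and X = 1 gives (a + b)^p. -/
lemma tracial_add_pow_char (p : ℕ) [hp : Fact p.Prime] (hW : ∀ w : W, p • w = 0)
    (τ : R →+ W) (hτ : ∀ a b, τ (a * b) = τ (b * a)) (a b : R) :
    τ ((a + b) ^ p) = τ (a ^ p) + τ (b ^ p) := by
  set f : Polynomial R := Polynomial.C a * Polynomial.X + Polynomial.C b with hf
  have hdeg : f.natDegree ≤ 1 := Polynomial.natDegree_linear_le
  have hdegp : (f ^ p).natDegree < p + 1 := by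
    have := Polynomial.natDegree_pow_le_of_le p hdeg
    omega
  have heval : (f ^ p).eval 1 = (a + b) ^ p := by
    have : ∀ m : ℕ, (f ^ m).eval 1 = (a + b) ^ m := by
      intro m
      induction m with
      | zero => simp
      | succ m ih =>
        rw [pow_succ', hf, add_mul, mul_assoc, Polynomial.X_mul, Polynomial.eval_add,
          Polynomial.eval_C_mul, Polynomial.eval_mul_X, Polynomial.eval_C_mul, ← hf, ih, mul_one,
          pow_succ', add_mul]
    exact this p
  have hmid : ∀ n ∈ Finset.range (p + 1), n ≠ p → n ≠ 0 → τ ((f ^ p).coeff n) = 0 := by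
    intro n hn hnp hn0
    obtain ⟨n, rfl⟩ := Nat.exists_eq_succ_of_ne_zero hn0
    have h1 := tracial_coeff_derivative_pow_mul τ hτ f n p 0
    rw [pow_zero, mul_one, hW, Polynomial.coeff_derivative, ← Nat.cast_succ,
      ← Nat.cast_comm, ← nsmul_eq_mul, map_nsmul] at h1
    have hc : Nat.Coprime n.succ p := (Nat.coprime_comm.mp ((Nat.Prime.coprime_iff_not_dvd hp.out).2
      (Nat.not_dvd_of_pos_of_lt n.succ_pos (by simp at hn; omega))))
    have h2 : addOrderOf (τ ((f ^ p).coeff n.succ)) ∣ Nat.gcd n.succ p :=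
      Nat.dvd_gcd (addOrderOf_dvd_of_nsmul_eq_zero h1) (addOrderOf_dvd_of_nsmul_eq_zero (hW _))
    rw [hc] at h2
    exact AddMonoid.addOrderOf_eq_one_iff.mp (Nat.dvd_one.mp h2)
  rw [← heval, Polynomial.eval_eq_sum_range' hdegp, map_sum, Finset.sum_range_succ,
    Finset.sum_eq_single_of_mem 0 (by simp [hp.out.pos])]
  · have h0 : (f ^ p).coeff 0 = b ^ p := by
      have : ∀ m : ℕ, (f ^ m).coeff 0 = b ^ m := by
        intro m
        induction m with
        | zero => simp
        | succ m ih => rw [pow_succ, Polynomial.mul_coeff_zero, ih, pow_succ]; simp [hf]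
      exact this p
    have h1 : (f ^ p).coeff p = a ^ p := by
      have := Polynomial.coeff_pow_of_natDegree_le hdeg (m := p)
      rw [mul_one] at this
      rw [this]
      simp [hf]
    simp [h0, h1, add_comm]
  · intro n hn hn0
    simpa using hmid n (by simp at hn ⊢; omega) (by simp at hn; omega) hn0

lemma tracial_sum_pow_char (p : ℕ) [hp : Fact p.Prime] (hW : ∀ w : W, p • w = 0)
    (τ : R →+ W) (hτ : ∀ a b, τ (a * b) = τ (b * a)) {ι : Type*} (s : Finset ι) (a : ι → R) :
    τ ((∑ i ∈ s, a i) ^ p) = ∑ i ∈ s, τ (a i ^ p) := by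
  classical
  induction s using Finset.induction_on with
  | empty => simp [hp.out.ne_zero]
  | insert i s hi ih =>
    rw [Finset.sum_insert hi, Finset.sum_insert hi, tracial_add_pow_char p hW τ hτ, ih]

end Tracial

/-! ### The Frobenius map on the commutator quotient -/

section CommutatorQuotient

lemma char_nsmul_eq_zero (k : Type*) [Field k] (p : ℕ) [CharP k p] {V : Type*}
    [AddCommGroup V] [Module k V] (w : V) : p • w = 0 := by
  rw [← Nat.cast_smul_eq_nsmul k, CharP.cast_eq_zero, zero_smul]

variable (k : Type*) [Field k] (Λ : Type*) [Ring Λ] [Algebra k Λ]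

variable {Λ} in
lemma mul_sub_mul_mem_commutatorSpace (a b : Λ) : a * b - b * a ∈ commutatorSpace k Λ :=
  Submodule.subset_span ⟨a, b, rfl⟩

/-- The quotient of an algebra by its commutator subspace. -/
abbrev CommQuot : Type _ := Λ ⧸ commutatorSpace k Λ

variable {Λ} in
/-- The class of an element in the quotient by the commutator subspace. -/
abbrev cls (a : Λ) : CommQuot k Λ := Submodule.Quotient.mk a

variable {Λ} in
lemma cls_mul_comm (a b : Λ) : cls k (a * b) = cls k (b * a) :=
  (Submodule.Quotient.eq _).2 (mul_sub_mul_mem_commutatorSpace k a b)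

variable (p : ℕ) [Fact p.Prime] [CharP k p]

variable {Λ} in
lemma cls_add_pow_char (a b : Λ) : cls k ((a + b) ^ p) = cls k (a ^ p) + cls k (b ^ p) :=
  tracial_add_pow_char p (char_nsmul_eq_zero k p) (commutatorSpace k Λ).mkQ.toAddMonoidHom
    (cls_mul_comm k) a b

lemma cls_pow_char_eq_zero {a : Λ} (ha : a ∈ commutatorSpace k Λ) : cls k (a ^ p) = 0 := by
  have hp : p ≠ 0 := (Fact.out : p.Prime).ne_zero
  induction ha using Submodule.span_induction with
  | zero => simp [hp]
  | add x y _ _ hx hy => rw [cls_add_pow_char, hx, hy, add_zero]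
  | smul c x _ hx =>
    rw [smul_pow, cls, Submodule.Quotient.mk_smul]
    exact (congrArg _ hx).trans (smul_zero _)
  | mem x hx =>
    obtain ⟨a, b, rfl⟩ := hx
    have h1 : cls k ((a * b) ^ p) = cls k ((b * a) ^ p) := by
      obtain ⟨q, rfl⟩ := Nat.exists_eq_succ_of_ne_zero hp
      rw [pow_succ', mul_assoc, cls_mul_comm, Nat.succ_eq_add_one, pow_succ, ← mul_assoc,
        mul_pow_mul, mul_assoc]
    -- Additivity for ab = (ab - ba) + ba: as (ab)^p and (ba)^p have the same class, that of (ab -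
    -- ba)^p is zero.
    have h2 := cls_add_pow_char k p (a * b - b * a) (b * a)
    rw [sub_add_cancel, h1] at h2
    exact (add_eq_right.mp h2.symm)

/-- The `p`-semilinear map on the quotient by the commutator subspace induced by `a ↦ a ^ p`. -/
def frob : CommQuot k Λ →+ CommQuot k Λ :=
  QuotientAddGroup.lift (commutatorSpace k Λ).toAddSubgroup
    { toFun := fun a => cls k (a ^ p)
      map_zero' := by simp [(Fact.out : p.Prime).ne_zero]
      map_add' := cls_add_pow_char k p }
    (fun _ ha => cls_pow_char_eq_zero k Λ p ha)

variable {Λ} in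
@[simp]
lemma frob_cls (a : Λ) : frob k Λ p (cls k a) = cls k (a ^ p) := rfl

variable {Λ} in
lemma iterate_frob_cls (r : ℕ) (a : Λ) : (frob k Λ p)^[r] (cls k a) = cls k (a ^ p ^ r) := by
  induction r generalizing a with
  | zero => simp
  | succ r ih => rw [Function.iterate_succ_apply, frob_cls, ih, ← pow_mul, ← pow_succ']

end CommutatorQuotient

/-! ### Traces of matrices over a field -/

section MatrixTrace

variable {K : Type*} [Field K] {n : Type*} [Fintype n] [DecidableEq n]

/-- Split M into multiples of matrix units and use additivity of the trace on p-th powers.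
Off-diagonal pieces square to zero and p ≥ 2, so only the p-th powers of the diagonal entries
survive. -/
lemma trace_pow_char (p : ℕ) [hp : Fact p.Prime] [CharP K p] (M : Matrix n n K) :
    (M ^ p).trace = M.trace ^ p := by
  have h := tracial_sum_pow_char p (char_nsmul_eq_zero K p)
    (Matrix.traceLinearMap n K K).toAddMonoidHom (fun a b => Matrix.trace_mul_comm a b)
    Finset.univ (fun x : n × n => Matrix.single x.1 x.2 (M x.1 x.2))
  have hM : ∑ x : n × n, Matrix.single x.1 x.2 (M x.1 x.2) = M := by
    rw [Fintype.sum_prod_type]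
    exact (Matrix.matrix_eq_sum_single M).symm
  rw [hM, Fintype.sum_prod_type] at h
  have hdiag : ∀ (i : n) (a : K) (m : ℕ), Matrix.single i i a ^ (m + 1) =
      Matrix.single i i (a ^ (m + 1)) := by
    intro i a m
    induction m with
    | zero => simp
    | succ m ih => rw [pow_succ, ih, Matrix.single_mul_single_same, ← pow_succ]
  obtain ⟨m, hm⟩ := Nat.exists_eq_succ_of_ne_zero hp.out.ne_zero
  have hm0 : m ≠ 0 := by rintro rfl; exact hp.out.ne_one hm
  refine h.trans ?_
  rw [Matrix.trace, sum_pow_char]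
  refine Finset.sum_congr rfl fun i _ => ?_
  rw [Finset.sum_eq_single i]
  · change Matrix.trace _ = _
    rw [hm, hdiag, Matrix.trace_single_eq_same, Matrix.diag_apply]
  · intro j _ hj
    change Matrix.trace _ = _
    obtain ⟨l, rfl⟩ := Nat.exists_eq_succ_of_ne_zero hm0
    change (Matrix.single i j (M i j) ^ p).trace = 0
    rw [hm, pow_succ, pow_succ, mul_assoc,
      Matrix.single_mul_single_of_ne _ _ _ _ hj, mul_zero, Matrix.trace_zero]
  · simp

lemma trace_pow_char_pow (p : ℕ) [Fact p.Prime] [CharP K p] (M : Matrix n n K) (r : ℕ) :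
    (M ^ p ^ r).trace = M.trace ^ p ^ r := by
  induction r with
  | zero => simp
  | succ r ih => rw [pow_succ, pow_mul, trace_pow_char, ih, ← pow_mul]

/-- A tracial functional kills off-diagonal units and takes one common value on the diagonal ones,
so it is a multiple of the trace. -/
lemma tracial_eq_zero_of_trace_eq_zero (φ : Matrix n n K →ₗ[K] K)
    (hφ : ∀ a b, φ (a * b) = φ (b * a)) (M : Matrix n n K) (hM : M.trace = 0) : φ M = 0 := by
  have hoff : ∀ i j (a : K), i ≠ j → φ (Matrix.single i j a) = 0 := by
    intro i j a hij
    have : Matrix.single i j a = Matrix.single i i 1 * Matrix.single i j a := by simp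
    rw [this, hφ, Matrix.single_mul_single_of_ne _ _ _ _ hij.symm, map_zero]
  have hdiag : ∀ i j (a : K), φ (Matrix.single i i a) = a * φ (Matrix.single j j 1) := by
    intro i j a
    have h1 : Matrix.single i i a = Matrix.single i j a * Matrix.single j i 1 := by simp
    have h2 : Matrix.single j i (1 : K) * Matrix.single i j a = a • Matrix.single j j 1 := by simp
    rw [h1, hφ, h2, map_smul, smul_eq_mul]
  rw [Matrix.matrix_eq_sum_single M, map_sum]
  rcases isEmpty_or_nonempty n with h | ⟨⟨j₀⟩⟩
  · simp
  · calc ∑ i, φ (∑ j, Matrix.single i j (M i j))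
        = ∑ i, M i i * φ (Matrix.single j₀ j₀ 1) := by
          refine Finset.sum_congr rfl fun i _ => ?_
          rw [map_sum, Finset.sum_eq_single i, hdiag i j₀]
          · exact fun j _ hj => hoff _ _ _ hj.symm
          · simp
      _ = 0 := by
          rw [← Finset.sum_mul]
          change M.trace * _ = 0
          rw [hM, zero_mul]

end MatrixTrace

/-! ### Central simple algebras, by extension of scalars -/

section CentralSimple

open scoped TensorProduct

variable (F A : Type*) [Field F] [Ring A] [Algebra F A]

/-- A central simple algebra is generated by left and right multiplications as a ring of
linear endomorphisms. -/
lemma mulLeftRight_surjective [FiniteDimensional F A] [IsSimpleRing A] [Algebra.IsCentral F A] :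
    Function.Surjective (AlgHom.mulLeftRight F A) := by
  let _ : Module (A ⊗[F] Aᵐᵒᵖ) A := TensorProduct.Algebra.module
  have hsm : ∀ (a : A) (b : Aᵐᵒᵖ) (x : A), (a ⊗ₜ[F] b) • x = a * x * b.unop := fun a b x =>
    AlgHom.mulLeftRight_apply F A a b x
  have hl : ∀ a x : A, (a ⊗ₜ[F] (1 : Aᵐᵒᵖ)) • x = a * x := fun a x => by simp [hsm]
  have hr : ∀ b x : A, ((1 : A) ⊗ₜ[F] MulOpposite.op b) • x = x * b := fun a x => by simp [hsm]
  -- Submodules of A over A ⊗ Aᵐᵒᵖ are two-sided ideals, so a nonzero x generates everything.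
  have hsimple : IsSimpleModule (A ⊗[F] Aᵐᵒᵖ) A := by
    refine isSimpleModule_iff_toSpanSingleton_surjective.2 ⟨inferInstance, fun x hx => ?_⟩
    let I : TwoSidedIdeal A := TwoSidedIdeal.mk'
      (Set.range (LinearMap.toSpanSingleton (A ⊗[F] Aᵐᵒᵖ) A x)) ⟨0, map_zero _⟩
      (by rintro _ _ ⟨s, rfl⟩ ⟨t, rfl⟩; exact ⟨s + t, by simp [add_smul]⟩)
      (by rintro _ ⟨s, rfl⟩; exact ⟨-s, by simp⟩)
      (by rintro a _ ⟨s, rfl⟩; exact ⟨a ⊗ₜ 1 * s, by simp [mul_smul, hl]⟩)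
      (by rintro _ b ⟨s, rfl⟩; exact ⟨1 ⊗ₜ MulOpposite.op b * s, by simp [mul_smul, hr]⟩)
    have hxI : x ∈ I := ⟨1, by simp⟩
    have h1 := IsSimpleRing.one_mem_of_ne_zero_mem I hx hxI
    intro y
    have hy : y * 1 ∈ I := I.mul_mem_left y 1 h1
    rw [mul_one] at hy
    have h2 := (TwoSidedIdeal.mem_mk' _ _ _ _ _ _ y).1 hy
    exact h2
  intro L
  -- A bimodule endomorphism is multiplication by its value at 1, which is central and so a scalar.
  -- Hence L commutes with all of them, and the density theorem on a finite basis realizes L.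
  have hcomm : ∀ (g : Module.End (A ⊗[F] Aᵐᵒᵖ) A), ∃ c : F, ∀ x, g x = c • x := by
    intro g
    have h1 : ∀ x, g x = x * g 1 := fun x => by rw [← hl, ← map_smul, hl, mul_one]
    have h2 : ∀ x, g x = g 1 * x := fun x => by rw [← hr, ← map_smul, hr, one_mul]
    obtain ⟨c, hc⟩ := Algebra.IsCentral.mem_center_iff F |>.1
      (Subalgebra.mem_center_iff.2 fun x => (h1 x).symm.trans (h2 x))
    exact ⟨c, fun x => by rw [h2, hc, Algebra.smul_def]⟩
  let f : Module.End (Module.End (A ⊗[F] Aᵐᵒᵖ) A) A :=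
    { toFun := L
      map_add' := map_add L
      map_smul' := fun g x => by
        obtain ⟨c, hc⟩ := hcomm g
        simp [hc] }
  classical
  obtain ⟨t, ht⟩ := jacobson_density f (Finset.univ.image (Module.finBasis F A))
  exact ⟨t, (Module.finBasis F A).ext fun i => (ht _ (by simp)).symm⟩

/-- Every F-linear L : A → A is a sum of left-right multiplications, so ideals of K ⊗ A are stable
under the base change of L. With L a coordinate function times 1, a nonzero element of the ideal is
sent to a nonzero scalar. -/
lemma isSimpleRing_baseChange [FiniteDimensional F A] [IsSimpleRing A] [Algebra.IsCentral F A]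
    (K : Type*) [Field K] [Algebra F K] : IsSimpleRing (K ⊗[F] A) := by
  refine .of_eq_bot_or_eq_top fun I => ?_
  rw [or_iff_not_imp_left, ← I.one_mem_iff]
  intro hI
  obtain ⟨x, hxI, hx : x ≠ 0⟩ := SetLike.exists_of_lt (bot_lt_iff_ne_bot.mpr hI : ⊥ < I)
  have hstable : ∀ (L : A →ₗ[F] A), L.baseChange K x ∈ I := by
    intro L
    obtain ⟨t, rfl⟩ := mulLeftRight_surjective F A L
    induction t using TensorProduct.induction_on with
    | zero => simp [I.zero_mem]
    | add s t hs ht =>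
      rw [map_add, LinearMap.baseChange_add]
      exact I.add_mem hs ht
    | tmul a b =>
      have : (AlgHom.mulLeftRight F A (a ⊗ₜ b)).baseChange K x =
          (1 ⊗ₜ[F] a) * x * (1 ⊗ₜ[F] b.unop) := by
        clear hxI hx
        induction x using TensorProduct.induction_on with
        | zero => simp
        | add y z hy hz => rw [map_add, hy, hz, mul_add, add_mul]
        | tmul c y => simp
      rw [this]
      exact I.mul_mem_right _ _ (I.mul_mem_left _ _ hxI)
  let v := Module.finBasis F A
  let w := Algebra.TensorProduct.basis K v
  obtain ⟨j, hj⟩ : ∃ j, w.repr x j ≠ 0 := by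
    by_contra! h
    exact hx (w.repr.map_eq_zero_iff.1 (Finsupp.ext h))
  have h := hstable ((v.coord j).smulRight 1)
  have hL : ((v.coord j).smulRight (1 : A)).baseChange K x = w.repr x j ⊗ₜ[F] (1 : A) := by
    have : ((v.coord j).smulRight (1 : A)).baseChange K =
        (w.coord j).smulRight (1 : K ⊗[F] A) := by
      refine w.ext fun i => ?_
      simp only [w, Algebra.TensorProduct.basis_apply, LinearMap.baseChange_tmul,
        LinearMap.smulRight_apply, Module.Basis.coord_apply, Module.Basis.repr_self,
        Algebra.TensorProduct.basis_repr_tmul]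
      rw [Finsupp.single_apply]
      split_ifs with hij
      · subst hij; simp [Algebra.TensorProduct.one_def]
      · simp [hij]
    rw [this]
    simp [Algebra.TensorProduct.one_def, TensorProduct.smul_tmul']
  rw [hL] at h
  have := I.mul_mem_left ((w.repr x j)⁻¹ ⊗ₜ[F] (1 : A)) _ h
  rwa [Algebra.TensorProduct.tmul_mul_tmul, inv_mul_cancel₀ hj, one_mul] at this

/-- If b were not a sum of commutators, a tracial φ would satisfy φ(b) ≠ 0. Over the algebraic
closure A becomes a matrix algebra, where the image of b has trace zero because the p^r-th power of
that trace is the trace of b^(p^r). The extension of φ is tracial, so it vanishes on b. -/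
lemma mem_commutatorSpace_of_pow_mem_of_isCentral [FiniteDimensional F A] [IsSimpleRing A]
    [Algebra.IsCentral F A] (p : ℕ) [Fact p.Prime] [CharP F p] (r : ℕ) (b : A)
    (hb : b ^ p ^ r ∈ commutatorSpace F A) : b ∈ commutatorSpace F A := by
  by_contra hb'
  obtain ⟨φ, hφb, hφ⟩ := Submodule.exists_le_ker_of_notMem hb'
  have hφc : ∀ a b, φ (a * b) = φ (b * a) := fun a b => by
    have := hφ (mul_sub_mul_mem_commutatorSpace F a b)
    rwa [LinearMap.mem_ker, map_sub, sub_eq_zero] at this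
  let K := AlgebraicClosure F
  have := isSimpleRing_baseChange F A K
  have : CharP K p := charP_of_injective_algebraMap (algebraMap F K).injective p
  obtain ⟨n, _, ⟨e⟩⟩ := IsSimpleRing.exists_algEquiv_matrix_of_isAlgClosed K (K ⊗[F] A)
  let ι : A →ₐ[F] Matrix (Fin n) (Fin n) K :=
    (e.toAlgHom.restrictScalars F).comp Algebra.TensorProduct.includeRight
  let ψ : K ⊗[F] A →ₗ[K] K := 
    (TensorProduct.AlgebraTensorModule.rid F K K).toLinearMap ∘ₗ φ.baseChange K
  have hψt : ∀ (c : K) (a : A), ψ (c ⊗ₜ a) = φ a • c := fun c a => by simp [ψ]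
  have hψ : ∀ x y, ψ (x * y) = ψ (y * x) := by
    intro x y
    induction x using TensorProduct.induction_on with
    | zero => simp
    | add x₁ x₂ h₁ h₂ => rw [add_mul, mul_add, map_add, map_add, h₁, h₂]
    | tmul c a =>
      induction y using TensorProduct.induction_on with
      | zero => simp
      | add x₁ x₂ h₁ h₂ => rw [add_mul, mul_add, map_add, map_add, h₁, h₂]
      | tmul d a' =>
        rw [Algebra.TensorProduct.tmul_mul_tmul, Algebra.TensorProduct.tmul_mul_tmul, hψt, hψt,
          hφc, mul_comm]
  have h0 : ψ (e.symm (ι b)) = 0 := by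
    refine tracial_eq_zero_of_trace_eq_zero (ψ ∘ₗ e.symm.toLinearMap) ?_ _ ?_
    · intro x y
      simp [hψ]
    · have h1 : (ι (b ^ p ^ r)).trace = 0 := by
        have : commutatorSpace F A ≤
            LinearMap.ker (((Matrix.traceLinearMap (Fin n) K K).restrictScalars F) ∘ₗ
              ι.toLinearMap) := by
          refine Submodule.span_le.2 ?_
          rintro _ ⟨x, y, rfl⟩
          simp [Matrix.trace_mul_comm (ι x)]
        exact this hb
      rw [map_pow, trace_pow_char_pow] at h1
      exact pow_eq_zero_iff (pow_ne_zero _ (Fact.out : p.Prime).ne_zero) |>.1 h1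
  have h2 : ψ (e.symm (ι b)) = algebraMap F K (φ b) := by
    have : e.symm (ι b) = 1 ⊗ₜ[F] b := e.symm_apply_apply _
    rw [this, hψt, Algebra.smul_def, mul_one]
  rw [h2, map_eq_zero] at h0
  exact hφb h0

end CentralSimple

/-! ### From simple algebras to semisimple ones, and modulo the radical -/

section Semisimple

variable (k : Type*) [Field k] {A B : Type*} [Ring A] [Algebra k A] [Ring B] [Algebra k B]

/-- Units need not be preserved, so that the inclusion of a factor into a product is allowed. -/
lemma map_mem_commutatorSpace (f : A →ₗ[k] B) (hf : ∀ a b, f (a * b) = f a * f b) {a : A}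
    (ha : a ∈ commutatorSpace k A) : f a ∈ commutatorSpace k B := by
  have : commutatorSpace k A ≤ (commutatorSpace k B).comap f := by
    refine Submodule.span_le.2 ?_
    rintro _ ⟨x, y, rfl⟩
    simpa [hf] using mul_sub_mul_mem_commutatorSpace k (f x) (f y)
  exact this ha

lemma center_mul_mem_commutatorSpace {c a : A} (hc : c ∈ Subalgebra.center k A)
    (ha : a ∈ commutatorSpace k A) : c * a ∈ commutatorSpace k A := by
  have : commutatorSpace k A ≤ (commutatorSpace k A).comap (LinearMap.mulLeft k c) := by
    refine Submodule.span_le.2 ?_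
    rintro _ ⟨x, y, rfl⟩
    have h := mul_sub_mul_mem_commutatorSpace k (c * x) y
    rw [← mul_assoc y, (Subalgebra.mem_center_iff.1 hc y), mul_assoc, mul_assoc, ← mul_sub] at h
    exact h
  exact this ha

variable (p : ℕ) [Fact p.Prime] [CharP k p]

lemma exists_isCentral_of_isSimpleRing (A : Type w) [Ring A] [Algebra k A] [IsSimpleRing A] :
    ∃ (F : Type w) (_ : Field F) (_ : Algebra k F) (_ : Algebra F A),
      IsScalarTower k F A ∧ Algebra.IsCentral F A := by
  let _ : Field (Subring.center A) := IsField.toField (IsSimpleRing.isField_center A)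
  let _ : Algebra k (Subring.center A) := RingHom.toAlgebra
    ((algebraMap k A).codRestrict (Subring.center A) fun c =>
      Subring.mem_center_iff.2 fun x => (Algebra.commutes c x).symm)
  let _ : Algebra (Subring.center A) A := RingHom.toAlgebra' (Subring.center A).subtype
    fun c x => (Subring.mem_center_iff.1 c.2 x).symm
  refine ⟨Subring.center A, inferInstance, inferInstance, inferInstance,
    IsScalarTower.of_algebraMap_eq fun _ => rfl, ⟨fun x hx => ?_⟩⟩
  exact Algebra.mem_bot.2 ⟨⟨x, Subring.mem_center_iff.2 (Subalgebra.mem_center_iff.1 hx)⟩, rfl⟩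

/-- A is central simple over its center F, and the commutator spaces over F and over k coincide
because central multiples of commutators are commutators. -/
lemma mem_commutatorSpace_of_pow_mem_of_isSimpleRing [FiniteDimensional k A] [IsSimpleRing A]
    (r : ℕ) (b : A) (hb : b ^ p ^ r ∈ commutatorSpace k A) : b ∈ commutatorSpace k A := by
  obtain ⟨F, _, _, _, _, _⟩ := exists_isCentral_of_isSimpleRing k A
  have : FiniteDimensional F A := Module.Finite.of_restrictScalars_finite k F A
  have : CharP F p := charP_of_injective_algebraMap (algebraMap k F).injective p
  have h1 : commutatorSpace k A ≤ (commutatorSpace F A).restrictScalars k := by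
    refine Submodule.span_le.2 ?_
    rintro _ ⟨x, y, rfl⟩
    exact mul_sub_mul_mem_commutatorSpace F x y
  have h2 := mem_commutatorSpace_of_pow_mem_of_isCentral F A p r b (h1 hb)
  clear hb
  induction h2 using Submodule.span_induction with
  | mem x hx => exact Submodule.subset_span hx
  | zero => exact zero_mem _
  | add x y _ _ hx hy => exact add_mem hx hy
  | smul c x _ hx =>
    rw [Algebra.smul_def]
    exact center_mul_mem_commutatorSpace k
      (Subalgebra.mem_center_iff.2 fun y => (Algebra.commutes c y).symm) hx

lemma mem_commutatorSpace_of_pow_mem_of_isSemisimpleRing [FiniteDimensional k A]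
    [IsSemisimpleRing A]
    (r : ℕ) (b : A) (hb : b ^ p ^ r ∈ commutatorSpace k A) : b ∈ commutatorSpace k A := by
  obtain ⟨n, D, d, _, _, _, _, ⟨e⟩⟩ :=
    IsSemisimpleRing.exists_algEquiv_pi_matrix_divisionRing_finite k A
  have h : ∀ i, e b i ∈ commutatorSpace k (Matrix (Fin (d i)) (Fin (d i)) (D i)) := by
    intro i
    refine mem_commutatorSpace_of_pow_mem_of_isSimpleRing k p r _ ?_
    have := map_mem_commutatorSpace k ((LinearMap.proj i) ∘ₗ e.toLinearMap) (fun a b => by simp) hb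
    simpa using this
  have h2 : b = ∑ i, e.symm (Pi.single i (e b i)) := by
    rw [← map_sum, Finset.univ_sum_single, e.symm_apply_apply]
  rw [h2]
  refine sum_mem fun i _ => ?_
  exact map_mem_commutatorSpace k (e.symm.toLinearMap ∘ₗ LinearMap.single k _ i)
    (fun a b => by simp [← map_mul, Pi.single_mul]) (h i)

lemma exists_sub_mem_jacobson_of_pow_mem [FiniteDimensional k A] (r : ℕ) (b : A)
    (hb : b ^ p ^ r ∈ commutatorSpace k A) :
    ∃ c ∈ commutatorSpace k A, b - c ∈ Ring.jacobson A := by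
  have := IsArtinianRing.of_finite k A
  let π := Ideal.Quotient.mkₐ k (Ring.jacobson A)
  have hπ : Function.Surjective π := Ideal.Quotient.mkₐ_surjective k _
  have h1 : π b ∈ commutatorSpace k (A ⧸ Ring.jacobson A) :=
    mem_commutatorSpace_of_pow_mem_of_isSemisimpleRing k p r _ (by
      rw [← map_pow]
      exact map_mem_commutatorSpace k π.toLinearMap (map_mul π) hb)
  have h2 : commutatorSpace k (A ⧸ Ring.jacobson A) ≤
      (commutatorSpace k A).map π.toLinearMap := by
    refine Submodule.span_le.2 ?_
    rintro _ ⟨x, y, rfl⟩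
    obtain ⟨x, rfl⟩ := hπ x
    obtain ⟨y, rfl⟩ := hπ y
    exact ⟨_, mul_sub_mul_mem_commutatorSpace k x y, by simp⟩
  obtain ⟨c, hc, hcb⟩ := h2 h1
  exact ⟨c, hc, Ideal.Quotient.eq.1 hcb.symm⟩

end Semisimple

/-! ### Passage to the opposite algebra -/

section Op

variable {k : Type*} [Field k] {Λ : Type*} [Ring Λ] [Algebra k Λ]

lemma op_mem_commutatorSpace {b : Λ} (hb : b ∈ commutatorSpace k Λ) :
    MulOpposite.op b ∈ commutatorSpace k Λᵐᵒᵖ := by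
  have : commutatorSpace k Λ ≤
      (commutatorSpace k Λᵐᵒᵖ).comap (MulOpposite.opLinearEquiv k).toLinearMap := by
    refine Submodule.span_le.2 ?_
    rintro _ ⟨x, y, rfl⟩
    exact mul_sub_mul_mem_commutatorSpace k (MulOpposite.op y) (MulOpposite.op x)
  exact this hb

lemma unop_mem_commutatorSpace {b : Λᵐᵒᵖ} (hb : b ∈ commutatorSpace k Λᵐᵒᵖ) :
    b.unop ∈ commutatorSpace k Λ := by
  have : commutatorSpace k Λᵐᵒᵖ ≤
      (commutatorSpace k Λ).comap (MulOpposite.opLinearEquiv k).symm.toLinearMap := by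
    refine Submodule.span_le.2 ?_
    rintro _ ⟨x, y, rfl⟩
    exact mul_sub_mul_mem_commutatorSpace k y.unop x.unop
  exact this hb

end Op

/-! ### Symmetrizing forms and the classical Külshammer ideals -/

section Symmetrizing

variable {k : Type*} [Field k] {Λ : Type*} [Ring Λ] [Algebra k Λ]
  {B : LinearMap.BilinForm k Λ} (hB : IsSymmetrizingForm B)

namespace IsSymmetrizingForm

lemma apply_eq_apply_mul_one (hB : IsSymmetrizingForm B) (a b : Λ) : B a b = B (a * b) 1 := by
  rw [hB.assoc, mul_one]

lemma mul_comm_one (hB : IsSymmetrizingForm B) (a b : Λ) : B (a * b) 1 = B (b * a) 1 := by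
  rw [← hB.apply_eq_apply_mul_one, hB.symm, hB.apply_eq_apply_mul_one]

lemma eq_zero_of_forall (hB : IsSymmetrizingForm B) {a : Λ} (h : ∀ b, B a b = 0) : a = 0 :=
  hB.nondegenerate.1 a h

/-- The identity `key` moves the commutator from the pair x, y to the pair a, x; nondegeneracy does
the rest. -/
lemma mem_center_iff (hB : IsSymmetrizingForm B) {a : Λ} :
    a ∈ Subalgebra.center k Λ ↔ ∀ c ∈ commutatorSpace k Λ, B c a = 0 := by
  have key : ∀ x y, B (x * y - y * x) a = B (a * x - x * a) y := fun x y => by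
    rw [map_sub, map_sub, LinearMap.sub_apply, LinearMap.sub_apply, hB.symm (x * y), ← hB.assoc,
      hB.assoc y, hB.symm y]
  constructor
  · intro ha c hc
    have : commutatorSpace k Λ ≤ LinearMap.ker (B.flip a) := by
      refine Submodule.span_le.2 ?_
      rintro _ ⟨x, y, rfl⟩
      change B _ a = 0
      rw [key, Subalgebra.mem_center_iff.1 ha, sub_self, map_zero, LinearMap.zero_apply]
    exact this hc
  · intro h
    refine Subalgebra.mem_center_iff.2 fun x => ?_
    refine (sub_eq_zero.1 (hB.eq_zero_of_forall fun y => ?_)).symm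
    rw [← key]
    exact h _ (mul_sub_mul_mem_commutatorSpace k x y)

lemma mem_commutatorSpace_iff (hB : IsSymmetrizingForm B) [FiniteDimensional k Λ] {c : Λ} :
    c ∈ commutatorSpace k Λ ↔ ∀ a ∈ Subalgebra.center k Λ, B a c = 0 := by
  have hrefl : B.IsRefl := fun x y h => by rw [hB.symm, h]
  have h := LinearMap.BilinForm.orthogonal_orthogonal hB.nondegenerate hrefl (commutatorSpace k Λ)
  have hc : ∀ a, a ∈ B.orthogonal (commutatorSpace k Λ) ↔ a ∈ Subalgebra.center k Λ :=
    fun a => hB.mem_center_iff.symm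
  rw [← h, LinearMap.BilinForm.mem_orthogonal_iff]
  simp only [hc]

end IsSymmetrizingForm

variable (k) in
lemma mem_kernel_of_mem_commutatorSpace (p : ℕ) [Fact p.Prime] [CharP k p] (r : ℕ) {c : Λ}
    (hc : c ∈ commutatorSpace k Λ) : c ^ p ^ r ∈ commutatorSpace k Λ := by
  have h := iterate_frob_cls k p r c
  rw [cls, (Submodule.Quotient.mk_eq_zero _).2 hc, iterate_map_zero] at h
  exact (Submodule.Quotient.mk_eq_zero _).1 h.symm

theorem idealK_eq_idealKcl [FiniteDimensional k Λ] (hB : IsSymmetrizingForm B) (p : ℕ)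
    [Fact p.Prime] [CharP k p] (r : ℕ) : idealK k Λ p r = idealKcl B p r := by
  ext a
  constructor
  · rintro ⟨_, h⟩ b hb
    rw [hB.apply_eq_apply_mul_one, hB.symm]
    exact hB.mem_commutatorSpace_iff.1 (h b hb) 1 (one_mem _)
  · intro h
    refine ⟨hB.mem_center_iff.2 fun c hc => ?_, fun b hb => ?_⟩
    · rw [hB.symm]
      exact h c (mem_kernel_of_mem_commutatorSpace k p r hc)
    · refine hB.mem_commutatorSpace_iff.2 fun z hz => ?_
      rw [hB.symm, hB.assoc]
      -- For central z, (bz)^(p^r) = z^(p^r) b^(p^r) is again in the commutator space, so `h`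
      -- applies to bz.
      refine h _ ?_
      have hcomm : Commute z b := (Subalgebra.mem_center_iff.1 hz b).symm
      rw [Subalgebra.mem_center_iff.1 hz, hcomm.mul_pow]
      exact center_mul_mem_commutatorSpace k (pow_mem hz _) hb

/-- The Reynolds ideal is the part of the center that annihilates `N`, for every set `N` of
nilpotent elements that is stable under right multiplication and that contains the elements with
a power in the commutator space, up to commutators. -/
lemma mem_idealR_iff [FiniteDimensional k Λ] (hB : IsSymmetrizingForm B) (p : ℕ)
    [Fact p.Prime] [CharP k p] (N : Set Λ) (hnil : ∀ j ∈ N, IsNilpotent j)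
    (hmul : ∀ j ∈ N, ∀ x, j * x ∈ N)
    (hN : ∀ (r : ℕ) (b : Λ), b ^ p ^ r ∈ commutatorSpace k Λ →
      ∃ c ∈ commutatorSpace k Λ, b - c ∈ N) (a : Λ) :
    a ∈ idealR k Λ p ↔ a ∈ Subalgebra.center k Λ ∧ ∀ j ∈ N, a * j = 0 := by
  rw [idealR, Set.mem_iInter]
  constructor
  · intro h
    refine ⟨(h 0).1, fun j hj => hB.eq_zero_of_forall fun x => ?_⟩
    -- The nilpotency index n also serves as the exponent r: since n ≤ p^n, the p^n-th power of jx
    -- vanishes.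
    obtain ⟨n, hn⟩ := hnil _ (hmul j hj x)
    have hr := h n
    rw [idealK_eq_idealKcl hB] at hr
    rw [hB.assoc]
    refine hr _ ?_
    have hle : n ≤ p ^ n := (Nat.lt_pow_self (Fact.out : p.Prime).one_lt).le
    rw [pow_eq_zero_of_le hle hn]
    exact zero_mem _
  · rintro ⟨ha, h⟩ r
    refine ⟨ha, fun b hb => ?_⟩
    obtain ⟨c, hc, hbc⟩ := hN r b hb
    have := h _ hbc
    rw [mul_sub, sub_eq_zero] at this
    rw [this]
    exact center_mul_mem_commutatorSpace k ha hc

end Symmetrizing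

/-! ### The socle as the annihilator of the radical -/

section Socle

/-- Simple modules are killed by the radical. Conversely, the elements killed by it form a module
over the semisimple quotient ring, hence a sum of simple submodules. -/
lemma mem_socle_iff {A M : Type*} [Ring A] [IsSemiprimaryRing A] [AddCommGroup M] [Module A M]
    (x : M) : x ∈ socle A M ↔ ∀ j ∈ Ring.jacobson A, j • x = 0 := by
  let S : Submodule A M :=
    { carrier := {x | ∀ j ∈ Ring.jacobson A, j • x = 0}
      zero_mem' := fun j _ => smul_zero j
      add_mem' := fun hx hy j hj => by rw [smul_add, hx j hj, hy j hj, add_zero]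
      smul_mem' := fun r x hx j hj => by
        rw [smul_smul]
        exact hx _ (Ideal.mul_mem_right r _ hj) }
  change x ∈ sSup _ ↔ x ∈ S
  suffices h : sSup {N : Submodule A M | IsSimpleModule A N} = S by rw [h]
  refine le_antisymm (sSup_le fun N hN x hx j hj => ?_) ?_
  · have : IsSimpleModule A N := hN
    have := Module.mem_annihilator.1 (IsSemisimpleModule.jacobson_le_annihilator A N hj) ⟨x, hx⟩
    exact congrArg Subtype.val this
  · have : Module.IsTorsionBySet A S (Ring.jacobson A) := fun y j =>
      Subtype.ext (y.2 j.1 j.2)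
    have : IsSemisimpleModule A S := by
      let _ := this.module
      exact (this.isSemisimpleModule_iff).1 inferInstance
    have h := congrArg (Submodule.map S.subtype) (IsSemisimpleModule.sSup_simples_eq_top A S)
    rw [Submodule.map_top, Submodule.range_subtype] at h
    rw [← h, (Submodule.gc_map_comap S.subtype).l_sSup]
    refine iSup₂_le fun N (hN : IsSimpleModule A N) => le_sSup ?_
    exact IsSimpleModule.congr (Submodule.equivSubtypeMap S N).symm

lemma isNilpotent_of_mem_jacobson {A : Type*} [Ring A] [IsSemiprimaryRing A] {j : A}
    (hj : j ∈ Ring.jacobson A) : IsNilpotent j := by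
  obtain ⟨n, hn⟩ := IsSemiprimaryRing.isNilpotent (R := A)
  refine ⟨n, ?_⟩
  have := Ideal.pow_mem_pow hj n
  rwa [hn] at this

variable {k : Type*} [Field k] {Λ : Type*} [Ring Λ] [Algebra k Λ] [FiniteDimensional k Λ]
  {B : LinearMap.BilinForm k Λ} (p : ℕ) [Fact p.Prime] [CharP k p]

theorem idealR_eq_center_inter_socle (hB : IsSymmetrizingForm B) :
    idealR k Λ p = (Subalgebra.center k Λ : Set Λ) ∩ (socle Λ Λ : Set Λ) := by
  have := IsArtinianRing.of_finite k Λ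
  ext a
  rw [mem_idealR_iff hB p (Ring.jacobson Λ) (fun j hj => isNilpotent_of_mem_jacobson hj)
    (fun j hj x => Ideal.mul_mem_right x _ hj)
    (fun r b hb => exists_sub_mem_jacobson_of_pow_mem k p r b hb)]
  refine and_congr_right fun ha => ?_
  rw [SetLike.mem_coe, mem_socle_iff]
  refine forall₂_congr fun j _ => ?_
  rw [smul_eq_mul, Subalgebra.mem_center_iff.1 ha]

/-- `mem_idealR_iff` is applied with the radical of the opposite algebra, so no left-right symmetry
of the radical enters. -/
theorem idealR_eq_center_inter_socle_op (hB : IsSymmetrizingForm B) :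
    idealR k Λ p = (Subalgebra.center k Λ : Set Λ) ∩ (socle Λᵐᵒᵖ Λ : Set Λ) := by
  have : FiniteDimensional k Λᵐᵒᵖ := Module.Finite.equiv (MulOpposite.opLinearEquiv k)
  have := IsArtinianRing.of_finite k Λᵐᵒᵖ
  ext a
  rw [mem_idealR_iff hB p {j | MulOpposite.op j ∈ Ring.jacobson Λᵐᵒᵖ}]
  · refine and_congr_right fun ha => ?_
    rw [SetLike.mem_coe, mem_socle_iff, MulOpposite.op_surjective.forall]
    rfl
  · intro j hj
    obtain ⟨n, hn⟩ := isNilpotent_of_mem_jacobson hj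
    exact ⟨n, MulOpposite.op_injective (by simpa using hn)⟩
  · intro j hj x
    exact Ideal.mul_mem_left (Ring.jacobson Λᵐᵒᵖ) (MulOpposite.op x) hj
  · intro r b hb
    obtain ⟨c, hc, hbc⟩ := exists_sub_mem_jacobson_of_pow_mem k p r (MulOpposite.op b)
      (by rw [← MulOpposite.op_pow]; exact op_mem_commutatorSpace hb)
    exact ⟨c.unop, unop_mem_commutatorSpace hc, by simpa using hbc⟩

end Socle

/-! ### Central multiplication and the trace form on the commutator quotient -/

section CenterAction

variable (k : Type*) [Field k] {Γ : Type*} [Ring Γ] [Algebra k Γ]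

/-- The action of a central element on the quotient by the commutator subspace. -/
def centerAct (z : Γ) (hz : z ∈ Subalgebra.center k Γ) : CommQuot k Γ →ₗ[k] CommQuot k Γ :=
  (commutatorSpace k Γ).mapQ _ (LinearMap.mulLeft k z)
    fun _ ha => center_mul_mem_commutatorSpace k hz ha

@[simp]
lemma centerAct_cls (z : Γ) (hz : z ∈ Subalgebra.center k Γ) (a : Γ) :
    centerAct k z hz (cls k a) = cls k (z * a) := rfl

variable {k} in
/-- The trace form of a symmetrizing form, on the quotient by the commutator subspace. -/
def IsSymmetrizingForm.traceForm {B : LinearMap.BilinForm k Γ} (hB : IsSymmetrizingForm B) :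
    CommQuot k Γ →ₗ[k] k :=
  (commutatorSpace k Γ).liftQ (B.flip 1) (Submodule.span_le.2 (by
    rintro _ ⟨x, y, rfl⟩
    simp [hB.mul_comm_one x y]))

variable {k} in
@[simp]
lemma IsSymmetrizingForm.traceForm_cls {B : LinearMap.BilinForm k Γ} (hB : IsSymmetrizingForm B)
    (a : Γ) : hB.traceForm (cls k a) = B a 1 := rfl

end CenterAction

/-! ### The Hattori-Stallings trace of projective modules -/

section HattoriTrace

/-- A finite dual basis of a module. -/
structure DualBasis (Γ M : Type*) [Ring Γ] [AddCommGroup M] [Module Γ M] where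
  /-- the number of elements -/
  n : ℕ
  /-- the generators -/
  e : Fin n → M
  /-- the coordinate functions -/
  s : Fin n → M →ₗ[Γ] Γ
  sum_smul : ∀ x, ∑ i, s i x • e i = x

lemma nonempty_dualBasis (Γ M : Type*) [Ring Γ] [AddCommGroup M] [Module Γ M]
    [Module.Finite Γ M] [Module.Projective Γ M] : Nonempty (DualBasis Γ M) := by
  obtain ⟨n, f, g, -, -, h⟩ := Module.Finite.exists_comp_eq_id_of_projective Γ M
  refine ⟨n, fun i => f (Pi.single i 1), fun i => LinearMap.proj i ∘ₗ g, fun x => ?_⟩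
  have := LinearMap.congr_fun h x
  conv_rhs => rw [← LinearMap.id_apply (R := Γ) x, ← this, LinearMap.comp_apply,
    ← Finset.univ_sum_single (g x), map_sum]
  refine Finset.sum_congr rfl fun i _ => ?_
  rw [← map_smul, ← Pi.single_smul, smul_eq_mul, mul_one]
  rfl

variable (k : Type*) [Field k] {Γ : Type*} [Ring Γ] [Algebra k Γ]
  {M N : Type*} [AddCommGroup M] [Module Γ M] [Module k M] [IsScalarTower k Γ M]
  [AddCommGroup N] [Module Γ N] [Module k N] [IsScalarTower k Γ N]

/-- The trace of an endomorphism that is computed with a dual basis. -/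
def DualBasis.trace (b : DualBasis Γ M) : (M →ₗ[Γ] M) →ₗ[k] CommQuot k Γ where
  toFun f := ∑ i, cls k (b.s i (f (b.e i)))
  map_add' f g := by simp [Finset.sum_add_distrib]
  map_smul' c f := by
    have : ∀ i, b.s i (c • f (b.e i)) = c • b.s i (f (b.e i)) := fun i => by
      rw [← algebraMap_smul Γ c, map_smul, smul_eq_mul, Algebra.smul_def]
    simp [Finset.smul_sum, this]

open Classical in
/-- The Hattori-Stallings trace of an endomorphism of a module with a finite dual basis. -/
noncomputable def htr : (M →ₗ[Γ] M) →ₗ[k] CommQuot k Γ :=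
  if h : Nonempty (DualBasis Γ M) then h.some.trace k else 0

lemma htr_eq_zero_of_subsingleton [Subsingleton M] (f : M →ₗ[Γ] M) : htr k f = 0 := by
  rw [Subsingleton.elim f 0, map_zero]

variable [Module.Finite Γ M] [Module.Projective Γ M] [Module.Finite Γ N] [Module.Projective Γ N]

variable (Γ M) in
lemma exists_htr_eq : ∃ b : DualBasis Γ M, ∀ f : M →ₗ[Γ] M,
    htr k f = ∑ i, cls k (b.s i (f (b.e i))) := by
  have h := nonempty_dualBasis Γ M
  exact ⟨h.some, fun f => by rw [htr, dif_pos h]; rfl⟩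

lemma htr_comp_comm (f : M →ₗ[Γ] N) (g : N →ₗ[Γ] M) : htr k (g ∘ₗ f) = htr k (f ∘ₗ g) := by
  obtain ⟨b, hb⟩ := exists_htr_eq k Γ M
  obtain ⟨c, hc⟩ := exists_htr_eq k Γ N
  have h1 : ∀ i, b.s i (g (f (b.e i))) = ∑ j, c.s j (f (b.e i)) * b.s i (g (c.e j)) := by
    intro i
    conv_lhs => rw [← c.sum_smul (f (b.e i))]
    simp
  have h2 : ∀ j, c.s j (f (g (c.e j))) = ∑ i, b.s i (g (c.e j)) * c.s j (f (b.e i)) := by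
    intro i
    conv_lhs => rw [← b.sum_smul (g (c.e i))]
    simp
  rw [hb, hc]
  simp only [LinearMap.comp_apply, h1, h2, ← Submodule.mkQ_apply, cls, map_sum]
  rw [Finset.sum_comm]
  exact Finset.sum_congr rfl fun _ _ => Finset.sum_congr rfl fun _ _ => cls_mul_comm k _ _

/-- Every endomorphism is a sum of such rank one maps; this formula yields both the Frobenius
property and nondegeneracy. -/
lemma htr_smulRight (s : M →ₗ[Γ] Γ) (y : M) : htr k (s.smulRight y) = cls k (s y) := by
  obtain ⟨b, hb⟩ := exists_htr_eq k Γ M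
  rw [hb]
  conv_rhs => rw [← b.sum_smul y]
  simp only [LinearMap.smulRight_apply, map_smul, smul_eq_mul, ← Submodule.mkQ_apply, cls, map_sum]
  exact Finset.sum_congr rfl fun _ _ => cls_mul_comm k _ _

lemma htr_of_forall_eq_smul (z : Γ) (hz : z ∈ Subalgebra.center k Γ) (f f' : M →ₗ[Γ] M)
    (h : ∀ x, f' x = z • f x) : htr k f' = centerAct k z hz (htr k f) := by
  obtain ⟨b, hb⟩ := exists_htr_eq k Γ M
  simp [hb, h]

lemma htr_pow_char (p : ℕ) [hp : Fact p.Prime] [CharP k p] (f : Module.End Γ M) :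
    htr k (f ^ p) = frob k Γ p (htr k f) := by
  obtain ⟨b, hb⟩ := exists_htr_eq k Γ M
  have hf : f = ∑ i, (b.s i).smulRight (f (b.e i)) := by
    ext x
    conv_lhs => rw [← b.sum_smul x]
    simp
  have hpow : ∀ (s : M →ₗ[Γ] Γ) (y : M) (m : ℕ),
      ((s.smulRight y : Module.End Γ M)) ^ (m + 1) = s.smulRight ((s y) ^ m • y) := by
    intro s y m
    induction m with
    | zero => simp
    | succ m ih =>
      rw [pow_succ, ih]
      ext x
      simp [smul_smul, pow_succ']
  have h := tracial_sum_pow_char p (char_nsmul_eq_zero k p)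
    ((htr k : (M →ₗ[Γ] M) →ₗ[k] CommQuot k Γ).toAddMonoidHom : Module.End Γ M →+ CommQuot k Γ)
    (fun f g => htr_comp_comm k g f) Finset.univ (fun i => (b.s i).smulRight (f (b.e i)))
  rw [← hf] at h
  refine h.trans ?_
  rw [hb, map_sum]
  refine Finset.sum_congr rfl fun i _ => ?_
  obtain ⟨m, rfl⟩ := Nat.exists_eq_succ_of_ne_zero hp.out.ne_zero
  rw [hpow, frob_cls]
  refine (htr_smulRight k _ _).trans ?_
  rw [map_smul, smul_eq_mul, ← pow_succ]

variable {k} {B : LinearMap.BilinForm k Γ} (hB : IsSymmetrizingForm B)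

set_option linter.unusedSectionVars false in
-- Testing against rank one maps y ↦ s_j(y)c·x gives the value of the form on s_j(u x) and c, so all
-- coordinates of u x vanish.
lemma eq_zero_of_traceForm_htr_eq_zero (u : M →ₗ[Γ] N)
    (hu : ∀ g : N →ₗ[Γ] M, hB.traceForm (htr k (u ∘ₗ g)) = 0) : u = 0 := by
  obtain ⟨b⟩ := nonempty_dualBasis Γ N
  ext x
  rw [LinearMap.zero_apply, ← b.sum_smul (u x)]
  refine Finset.sum_eq_zero fun j _ => ?_
  suffices h : b.s j (u x) = 0 by rw [h, zero_smul]
  refine hB.eq_zero_of_forall fun c => ?_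
  have h := hu ((LinearMap.toSpanSingleton Γ Γ c ∘ₗ b.s j).smulRight x)
  have h2 : u ∘ₗ (LinearMap.toSpanSingleton Γ Γ c ∘ₗ b.s j).smulRight x =
      (LinearMap.toSpanSingleton Γ Γ c ∘ₗ b.s j).smulRight (u x) := by
    ext y; simp
  rw [h2, htr_smulRight, hB.traceForm_cls] at h
  rw [hB.apply_eq_apply_mul_one]
  simpa using h

lemma exists_eq_traceForm_htr_comp [FiniteDimensional k Γ] (ψ : (N →ₗ[Γ] M) →ₗ[k] k) :
    ∃ h : M →ₗ[Γ] N, ∀ g, ψ g = hB.traceForm (htr k (g ∘ₗ h)) := by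
  have : Module.Finite k M := Module.Finite.trans Γ M
  have : Module.Finite k N := Module.Finite.trans Γ N
  have : FiniteDimensional k (M →ₗ[Γ] N) :=
    Module.Finite.of_injective (LinearMap.restrictScalarsₗ k Γ M N k)
      (LinearMap.restrictScalars_injective k)
  let P : (M →ₗ[Γ] N) →ₗ[k] (N →ₗ[Γ] M) →ₗ[k] k :=
    LinearMap.mk₂ k (fun h g => hB.traceForm (htr k (g ∘ₗ h)))
      (fun h h' g => by simp [LinearMap.comp_add])
      (fun c h g => by simp [LinearMap.comp_smul])
      (fun h g g' => by simp [LinearMap.add_comp])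
      (fun c h g => by simp [LinearMap.smul_comp])
  have hP : P.IsPerfPair := LinearMap.IsPerfPair.of_injective
    ((injective_iff_map_eq_zero P).2 fun h h0 => eq_zero_of_traceForm_htr_eq_zero hB h fun g => by
      rw [← htr_comp_comm]
      exact LinearMap.congr_fun h0 g)
    ((injective_iff_map_eq_zero P.flip).2 fun g h0 =>
      eq_zero_of_traceForm_htr_eq_zero hB g fun h => LinearMap.congr_fun h0 h)
  obtain ⟨h, rfl⟩ := hP.bijective_left.2 ψ
  exact ⟨h, fun g => rfl⟩

end HattoriTrace

open scoped ModuleCat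

/-! ### The supertrace of perfect complexes -/

section SuperTrace

variable (k : Type*) [Field k] {Γ : Type v} [Ring Γ] [Algebra k Γ]
  {K L : CochainComplex (ModuleCat.{v} Γ) ℤ}

/-- The supertrace of an endomorphism of a bounded complex of projective modules. -/
noncomputable def strace (φ : K ⟶ K) : CommQuot k Γ :=
  ∑ᶠ i : ℤ, i.negOnePow • htr k (φ.f i).hom

lemma finite_support_of_isPerfectComplex (hK : isPerfectComplex Γ K) {V : Type*} [AddCommGroup V]
    (F : ∀ i : ℤ, (K.X i ⟶ K.X i) → V) (hF : ∀ i, F i 0 = 0)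
    (φ : ∀ i : ℤ, K.X i ⟶ K.X i) : (Function.support fun i => F i (φ i)).Finite := by
  obtain ⟨⟨a, b, hab⟩, -⟩ := hK
  refine (Set.finite_Icc a b).subset fun i hi => ?_
  by_contra h
  have : Subsingleton (K.X i) := hab i (by
    simp only [Set.mem_Icc, not_and_or, not_le] at h
    exact h)
  refine hi ?_
  have h0 : φ i = 0 := by
    ext x
    exact Subsingleton.elim _ _
  simp [h0, hF]

lemma finite_support_strace (hK : isPerfectComplex Γ K) (φ : ∀ i : ℤ, K.X i ⟶ K.X i) :
    (Function.support fun i => i.negOnePow • htr k (φ i).hom).Finite :=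
  finite_support_of_isPerfectComplex hK (fun i (f : K.X i ⟶ K.X i) => i.negOnePow • htr k f.hom)
    (fun i => by simp) φ

lemma strace_add (hK : isPerfectComplex Γ K) (φ ψ : K ⟶ K) :
    strace k (φ + ψ) = strace k φ + strace k ψ := by
  rw [strace, strace, strace, ← finsum_add_distrib (finite_support_strace k hK φ.f)
    (finite_support_strace k hK ψ.f)]
  refine finsum_congr fun i => ?_
  rw [← smul_add, ← map_add]
  rfl

lemma strace_smul (c : k) (φ : K ⟶ K) : strace k (c • φ) = c • strace k φ := by
  rw [strace, strace, smul_finsum]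
  refine finsum_congr fun i => ?_
  rw [smul_comm, ← (htr k).map_smul]
  rfl

lemma strace_comp_comm (hK : isPerfectComplex Γ K) (hL : isPerfectComplex Γ L)
    (f : K ⟶ L) (g : L ⟶ K) : strace k (f ≫ g) = strace k (g ≫ f) := by
  refine finsum_congr fun i => ?_
  have := (hK.2 i).1
  have := (hK.2 i).2
  have := (hL.2 i).1
  have := (hL.2 i).2
  congr 1
  exact htr_comp_comm k (f.f i).hom (g.f i).hom

lemma strace_eq_centerAct (hK : isPerfectComplex Γ K) (z : Γ) (hz : z ∈ Subalgebra.center k Γ)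
    (φ φ' : K ⟶ K) (h : ∀ i (x : K.X i), φ'.f i x = z • φ.f i x) :
    strace k φ' = centerAct k z hz (strace k φ) := by
  refine (finsum_congr fun i => ?_).trans ((centerAct k z hz).toAddMonoidHom.map_finsum
    (finite_support_strace k hK φ.f)).symm
  have := (hK.2 i).1
  have := (hK.2 i).2
  rw [Units.smul_def, Units.smul_def, map_zsmul]
  congr 1
  exact htr_of_forall_eq_smul k z hz _ _ (h i)

lemma strace_pow_char (p : ℕ) [Fact p.Prime] [CharP k p] (hK : isPerfectComplex Γ K)
    (φ : End K) : strace k ((φ ^ p : End K) : K ⟶ K) = frob k Γ p (strace k φ) := by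
  have hpow : ∀ (m : ℕ) (i : ℤ), (HomologicalComplex.Hom.f ((φ ^ m : End K) : K ⟶ K) i).hom =
      ((HomologicalComplex.Hom.f (φ : K ⟶ K) i).hom : Module.End Γ (K.X i)) ^ m := by
    intro m i
    induction m with
    | zero => rfl
    | succ m ih =>
      rw [pow_succ', pow_succ', ← ih]
      rfl
  rw [strace, strace, AddMonoidHom.map_finsum _ (finite_support_strace k hK _)]
  refine finsum_congr fun i => ?_
  have := (hK.2 i).1
  have := (hK.2 i).2
  rw [Units.smul_def, Units.smul_def, map_zsmul, hpow, htr_pow_char k p]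

lemma strace_shift (hK : isPerfectComplex Γ K) (φ : K ⟶ K) (n : ℤ) :
    strace k (φ⟦n⟧') = n.negOnePow • strace k φ := by
  rw [strace, strace, smul_finsum' _ (finite_support_strace k hK φ.f), eq_comm,
    ← finsum_comp_equiv (Equiv.addRight n)]
  refine finsum_congr fun i => ?_
  rw [smul_smul, Equiv.coe_addRight, Int.negOnePow_add, mul_comm i.negOnePow, ← mul_assoc,
    Int.units_mul_self, one_mul]
  rfl

/-- By cyclicity the hd-part in degree i + 1 and the dh-part in degree i have equal traces; the
alternating signs cancel them. -/
lemma strace_eq_of_homotopy (hK : isPerfectComplex Γ K) {φ ψ : K ⟶ K} (h : Homotopy φ ψ) :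
    strace k φ = strace k ψ := by
  let b : ℤ → ℤ → CommQuot k Γ := fun i j => htr k (K.d i j ≫ h.hom j i).hom
  have hb : ∀ i, htr k (φ.f i).hom = b i (i + 1) + b (i - 1) i + htr k (ψ.f i).hom := by
    intro i
    have := (hK.2 i).1
    have := (hK.2 i).2
    have := (hK.2 (i - 1)).1
    have := (hK.2 (i - 1)).2
    have h1 : b (i - 1) i = htr k (h.hom i (i - 1) ≫ K.d (i - 1) i).hom :=
      htr_comp_comm k (K.d (i - 1) i).hom (h.hom i (i - 1)).hom
    rw [h1, h.comm i, dNext_eq h.hom (show (ComplexShape.up ℤ).Rel i (i + 1) by simp),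
      prevD_eq h.hom (show (ComplexShape.up ℤ).Rel (i - 1) i by simp), ← map_add, ← map_add]
    rfl
  have hfin : (Function.support fun i : ℤ => i.negOnePow • b i (i + 1)).Finite :=
    finite_support_strace k hK fun i => K.d i (i + 1) ≫ h.hom (i + 1) i
  have hfin' : (Function.support fun i : ℤ => i.negOnePow • b (i - 1) i).Finite := by
    refine Set.Finite.subset (finite_support_strace k hK
      fun i => h.hom i (i - 1) ≫ K.d (i - 1) i) fun i hi => ?_
    have := (hK.2 i).1
    have := (hK.2 i).2
    have := (hK.2 (i - 1)).1
    have := (hK.2 (i - 1)).2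
    have h1 : b (i - 1) i = htr k (h.hom i (i - 1) ≫ K.d (i - 1) i).hom :=
      htr_comp_comm k (K.d (i - 1) i).hom (h.hom i (i - 1)).hom
    rwa [Function.mem_support, h1] at hi
  have h2 : ∑ᶠ i : ℤ, i.negOnePow • b (i - 1) i = - ∑ᶠ i : ℤ, i.negOnePow • b i (i + 1) := by
    rw [← finsum_comp_equiv (Equiv.addRight (1 : ℤ)), ← finsum_neg_distrib]
    refine finsum_congr fun i => ?_
    simp [Int.negOnePow_succ]
  rw [strace, strace]
  simp only [hb, smul_add]
  rw [finsum_add_distrib _ (finite_support_strace k hK ψ.f), finsum_add_distrib hfin hfin', h2]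
  · simp
  · exact (hfin.union hfin').subset (Function.support_add _ _)

end SuperTrace

/-! ### Nondegeneracy of the supertrace pairing up to homotopy -/

section Nondegenerate

variable {k : Type*} [Field k] {Γ : Type v} [Ring Γ] [Algebra k Γ]
  {K L : CochainComplex (ModuleCat.{v} Γ) ℤ}

variable (k) in
/-- The differential, in degree zero, of the complex of morphisms from `L` to `K`. -/
def homDifferential (L K : CochainComplex (ModuleCat.{v} Γ) ℤ) :
    (∀ i : ℤ, L.X i ⟶ K.X i) →ₗ[k] (∀ x : ℤ × ℤ, L.X x.1 ⟶ K.X x.2) where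
  toFun g x := g x.1 ≫ K.d x.1 x.2 - L.d x.1 x.2 ≫ g x.2
  map_add' g g' := by
    funext x
    simp only [Pi.add_apply, Preadditive.add_comp, Preadditive.comp_add]
    abel
  map_smul' c g := by
    funext x
    simp only [Pi.smul_apply, Linear.smul_comp, Linear.comp_smul, smul_sub, RingHom.id_apply]

lemma homDifferential_single (i : ℤ) (g : L.X (i + 1) ⟶ K.X (i + 1)) :
    homDifferential k L K (Pi.single (i + 1) g) =
      Pi.single (M := fun x : ℤ × ℤ => (L.X x.1 ⟶ K.X x.2)) (i + 1, i + 1 + 1)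
        (g ≫ K.d (i + 1) (i + 1 + 1)) -
      Pi.single (M := fun x : ℤ × ℤ => (L.X x.1 ⟶ K.X x.2)) (i, i + 1) (L.d i (i + 1) ≫ g) := by
  funext ⟨a, b⟩
  change Pi.single (M := fun i => (L.X i ⟶ K.X i)) (i + 1) g a ≫ K.d a b -
    L.d a b ≫ Pi.single (M := fun i => (L.X i ⟶ K.X i)) (i + 1) g b = _
  by_cases hab : a + 1 = b
  · subst hab
    congr 1
    · by_cases ha : a = i + 1
      · subst ha
        simp
      · rw [Pi.single_eq_of_ne ha, Pi.single_eq_of_ne (by simp [ha]), Limits.zero_comp]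
    · by_cases ha : a = i
      · subst ha
        simp
      · rw [Pi.single_eq_of_ne (by omega), Pi.single_eq_of_ne (by simp [ha]), Limits.comp_zero]
  · have h1 : (a, b) ≠ (i + 1, i + 1 + 1) := fun h => hab (by
      rw [Prod.mk.injEq] at h; omega)
    have h2 : (a, b) ≠ (i, i + 1) := fun h => hab (by
      rw [Prod.mk.injEq] at h; omega)
    rw [K.shape _ _ hab, L.shape _ _ hab, Pi.sub_apply, Pi.single_eq_of_ne h1,
      Pi.single_eq_of_ne h2, Limits.comp_zero, Limits.zero_comp]

variable (k) in
lemma htr_hom_comp_comm {X Y : ModuleCat.{v} Γ} [Module.Finite Γ X] [Module.Projective Γ X]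
    [Module.Finite Γ Y] [Module.Projective Γ Y] (f : X ⟶ Y) (g : Y ⟶ X) :
    htr k (f ≫ g).hom = htr k (g ≫ f).hom :=
  htr_comp_comm k f.hom g.hom

variable [FiniteDimensional k Γ] {B : LinearMap.BilinForm k Γ} (hB : IsSymmetrizingForm B)

lemma nonempty_homotopy_zero_of_traceForm_strace_eq_zero (hK : isPerfectComplex Γ K)
    (hL : isPerfectComplex Γ L) (u : K ⟶ L)
    (hu : ∀ g : L ⟶ K, hB.traceForm (strace k (g ≫ u)) = 0) : Nonempty (Homotopy u 0) := by
  have (i : ℤ) := (hK.2 i).1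
  have (i : ℤ) := (hK.2 i).2
  have (i : ℤ) := (hL.2 i).1
  have (i : ℤ) := (hL.2 i).2
  let τ : (∀ i : ℤ, L.X i ⟶ K.X i) →ₗ[k] k := hB.traceForm ∘ₗ
    { toFun := fun g => ∑ᶠ i : ℤ, i.negOnePow • htr k (g i ≫ u.f i).hom
      map_add' := fun g g' => by
        rw [← finsum_add_distrib (finite_support_strace k hL _) (finite_support_strace k hL _)]
        refine finsum_congr fun i => ?_
        rw [← smul_add, ← map_add, Pi.add_apply, Preadditive.add_comp]
        rfl
      map_smul' := fun c g => by
        rw [RingHom.id_apply, smul_finsum]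
        refine finsum_congr fun i => ?_
        rw [smul_comm, ← (htr k).map_smul, Pi.smul_apply, Linear.smul_comp]
        rfl }
  -- Chain maps are the kernel of the differential. Since τ vanishes there, it factors as ψ after
  -- the differential; the components of ψ will supply the homotopy.
  have hτ : τ ∈ LinearMap.range (homDifferential k L K).dualMap := by
    rw [LinearMap.range_dualMap_eq_dualAnnihilator_ker, Submodule.mem_dualAnnihilator]
    intro g hg
    refine hu ⟨g, fun i j _ => ?_⟩
    exact sub_eq_zero.1 (congrFun (LinearMap.mem_ker.1 hg) (i, j))
  obtain ⟨ψ, hψ⟩ := hτ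
  have hex : ∀ i j : ℤ, ∃ h : K.X j ⟶ L.X i, ∀ g : L.X i ⟶ K.X j,
      ψ (Pi.single (M := fun x : ℤ × ℤ => (L.X x.1 ⟶ K.X x.2)) (i, j) g) =
        hB.traceForm (htr k (h ≫ g).hom) := by
    intro i j
    obtain ⟨h, hh⟩ := exists_eq_traceForm_htr_comp hB (M := K.X j) (N := L.X i)
      (ψ ∘ₗ LinearMap.single k (fun x : ℤ × ℤ => (L.X x.1 ⟶ K.X x.2)) (i, j) ∘ₗ
        (ModuleCat.homLinearEquiv (S := k)).symm.toLinearMap)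
    exact ⟨ModuleCat.ofHom h, fun g => hh g.hom⟩
  choose h hh using hex
  -- Evaluate τ and ψ on maps concentrated in degree i + 1 and use nondegeneracy of the module
  -- trace.
  have key : ∀ i : ℤ, u.f (i + 1) = (i + 1).negOnePow •
      (K.d (i + 1) (i + 1 + 1) ≫ h (i + 1) (i + 1 + 1) - h i (i + 1) ≫ L.d i (i + 1)) := by
    intro i
    rw [← sub_eq_zero]
    apply ModuleCat.hom_ext
    refine eq_zero_of_traceForm_htr_eq_zero hB _ fun g => ?_
    have h1 := LinearMap.congr_fun hψ (Pi.single (i + 1) (ModuleCat.ofHom g))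
    have h2 : τ (Pi.single (i + 1) (ModuleCat.ofHom g)) =
        hB.traceForm ((i + 1).negOnePow • htr k (ModuleCat.ofHom g ≫ u.f (i + 1)).hom) := by
      change hB.traceForm (∑ᶠ _, _) = _
      rw [finsum_eq_single _ (i + 1)]
      · rw [Pi.single_eq_same]
      · intro j hj
        rw [Pi.single_eq_of_ne hj]
        simp
    rw [h2, LinearMap.dualMap_apply, homDifferential_single, map_sub, hh, hh,
      htr_hom_comp_comm k (h (i + 1) _), htr_hom_comp_comm k (h i _), Category.assoc,
      Category.assoc, htr_hom_comp_comm k (L.d i (i + 1)), Category.assoc] at h1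
    have h3 : ∀ x y : L.X (i + 1) ⟶ L.X (i + 1), hB.traceForm (htr k (x - y).hom) =
        hB.traceForm (htr k x.hom) - hB.traceForm (htr k y.hom) := fun x y => by
      rw [← map_sub, ← map_sub]
      rfl
    have h4 : ∀ (ε : ℤˣ) (x : L.X (i + 1) ⟶ L.X (i + 1)), hB.traceForm (htr k (ε • x).hom) =
        hB.traceForm (ε • htr k x.hom) := fun ε x => by
      rw [Units.smul_def, Units.smul_def, ← map_zsmul]
      rfl
    have h5 : ∀ (ε : ℤˣ) (x : CommQuot k Γ), hB.traceForm (ε • x) = ε • hB.traceForm x :=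
      fun ε x => by rw [Units.smul_def, Units.smul_def, map_zsmul]
    change hB.traceForm (htr k (ModuleCat.ofHom g ≫ (_ - _)).hom) = 0
    rw [Preadditive.comp_sub, h3, Linear.comp_units_smul, Preadditive.comp_sub, h4, h5, h3, h1, h5,
      smul_smul, Int.units_mul_self, one_smul, sub_self]
  -- The sign (-1)^j absorbs the supertrace sign and turns the difference in `key` into the sum dh +
  -- hd.
  refine ⟨⟨fun i j => if j + 1 = i then j.negOnePow • h j i else 0, ?_, ?_⟩⟩
  · intro i j hij
    exact if_neg hij
  · intro i
    obtain ⟨i, rfl⟩ : ∃ j, i = j + 1 := ⟨i - 1, by simp⟩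
    rw [dNext_eq _ (show (ComplexShape.up ℤ).Rel (i + 1) (i + 1 + 1) by simp),
      prevD_eq _ (show (ComplexShape.up ℤ).Rel i (i + 1) by simp), if_pos rfl, if_pos rfl, key i]
    simp [Int.negOnePow_succ, sub_eq_add_neg]

variable (k) in
lemma finiteDimensional_hom (hK : isPerfectComplex Γ K) (hL : isPerfectComplex Γ L) :
    FiniteDimensional k (K ⟶ L) := by
  have (i : ℤ) := (hK.2 i).1
  have (i : ℤ) := (hL.2 i).1
  have (i : ℤ) : Module.Finite k (K.X i) := Module.Finite.trans Γ _
  have (i : ℤ) : Module.Finite k (L.X i) := Module.Finite.trans Γ _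
  obtain ⟨⟨a, b, hab⟩, -⟩ := hK
  let F : (K ⟶ L) →ₗ[k] (∀ i : Finset.Icc a b, (K.X i →ₗ[k] L.X i)) :=
    { toFun := fun f i => (f.f i).hom.restrictScalars k
      map_add' := fun f g => rfl
      map_smul' := fun c f => rfl }
  refine Module.Finite.of_injective F fun f g hfg => ?_
  ext i x
  by_cases hi : i ∈ Finset.Icc a b
  · exact LinearMap.congr_fun (congrFun hfg ⟨i, hi⟩) x
  · have : Subsingleton (K.X i) :=
      hab i (by simp only [Finset.mem_Icc, not_and_or, not_le] at hi; exact hi)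
    rw [Subsingleton.elim x 0, map_zero, map_zero]

end Nondegenerate

/-! ### Traces on a category with shift and on its orbit category -/

lemma exists_eq_shift_comp {C : Type v} [Category.{w} C] [HasShift C ℤ] {x y : C}
    {m m' : ℤ} (h : m' + m = 0) (g : y⟦m⟧ ⟶ x) :
    ∃ g' : ShiftedHom y x m', g'⟦m⟧' ≫ (shiftFunctorCompIsoId C m' m h).hom.app x = g := by
  obtain ⟨g', hg'⟩ := (shiftFunctor C m).map_surjective
    (g ≫ (shiftFunctorCompIsoId C m' m h).inv.app x)
  exact ⟨g', by rw [hg']; simp⟩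

section ShiftTrace

variable (k : Type u) [Field k] (C : Type v) [Category.{w} C] [Preadditive C] [Linear k C]
  [HasShift C ℤ] (W : Type*) [AddCommGroup W] [Module k W]

/-- A trace on the endomorphisms of a category with shift, that changes by the sign `(-1) ^ n`
under the shift by `n`. -/
structure ShiftTrace where
  /-- the trace -/
  tr : ∀ x : C, (x ⟶ x) →ₗ[k] W
  comm : ∀ {x y : C} (f : x ⟶ y) (g : y ⟶ x), tr x (f ≫ g) = tr y (g ≫ f)
  shift : ∀ {x : C} (f : x ⟶ x) (n : ℤ), tr (x⟦n⟧) (f⟦n⟧') = n.negOnePow • tr x f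

variable {k C W} (T : ShiftTrace k C W)

namespace ShiftTrace

/-- The trace of an endomorphism of degree zero in the orbit category. -/
noncomputable def deg {n : ℤ} (hn : n = 0) (x : C) : ShiftedHom x x n →ₗ[k] W :=
  T.tr x ∘ₗ Linear.rightComp k x ((shiftFunctorZero' C n hn).hom.app x)

lemma deg_mk₀ {n : ℤ} (hn : n = 0) {x : C} (f : x ⟶ x) :
    T.deg hn x (ShiftedHom.mk₀ n hn f) = T.tr x f := by
  simp [deg, ShiftedHom.mk₀]

lemma deg_comp {i j : ℤ} {n : ℤ} (hn : n = 0) {x y : C} (f : ShiftedHom x y i)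
    (g : ShiftedHom y x j) (h : j + i = n) :
    T.deg hn x (f.comp g h) =
      T.tr x (f ≫ g⟦i⟧' ≫ (shiftFunctorCompIsoId C j i (h.trans hn)).hom.app x) := by
  subst hn
  simp [deg, ShiftedHom.comp, shiftFunctorCompIsoId, shiftFunctorZero']

/-- Ordinary cyclicity produces the trace of the i-fold shift of gf, hence the sign (-1)^i. As j =
-i, this is (-1)^(ij). -/
lemma deg_comp_comm {i j : ℤ} {n : ℤ} (hn : n = 0) {x y : C} (f : ShiftedHom x y i)
    (g : ShiftedHom y x j) (hij : j + i = n) (hji : i + j = n) :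
    T.deg hn x (f.comp g hij) = (i * j).negOnePow • T.deg hn y (g.comp f hji) := by
  rw [deg_comp, deg_comp, T.comm, Category.assoc]
  have h1 := (shiftFunctorCompIsoId C j i (hij.trans hn)).hom.naturality f
  dsimp at h1
  rw [← h1, ← shift_shiftFunctorCompIsoId_hom_app, ← Functor.map_comp, ← Functor.map_comp, T.shift]
  swap
  · omega
  congr 1
  rw [Int.negOnePow_eq_iff]
  obtain rfl : j = -i := by omega
  rw [show i - i * -i = i * (i + 1) by ring]
  exact Int.even_mul_succ_self i

section Nondegenerate

variable (t : W →ₗ[k] k)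
  (ht : ∀ (x y : C) (u : x ⟶ y), (∀ g : y ⟶ x, t (T.tr x (u ≫ g)) = 0) → u = 0)

include ht

/-- Since the shift is an equivalence, `exists_eq_shift_comp` carries the nondegeneracy `ht` over to
the pairing of opposite degrees. -/
lemma eq_of_forall_deg_comp_eq {x y : C} {m m' : ℤ} (hm : m' + m = 0) (u u' : ShiftedHom x y m)
    (h : ∀ g : ShiftedHom y x m', t (T.deg rfl x (u.comp g hm)) = t (T.deg rfl x (u'.comp g hm))) :
    u = u' := by
  rw [← sub_eq_zero]
  refine ht _ _ _ fun g => ?_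
  obtain ⟨g, rfl⟩ := exists_eq_shift_comp hm g
  have := h g
  rw [deg_comp, deg_comp] at this
  rw [Preadditive.sub_comp, map_sub, map_sub, this, sub_self]

lemma exists_eq_deg_comp {n s : ℤ} (h : n + s = 0) (x : C) [FiniteDimensional k (x ⟶ x⟦s⟧)]
    (φ : ShiftedHom x x s →ₗ[k] k) :
    ∃ η : ShiftedHom x x n, ∀ g, φ g = t (T.deg rfl x (g.comp η h)) := by
  let P : (x⟦s⟧ ⟶ x) →ₗ[k] (x ⟶ x⟦s⟧) →ₗ[k] k :=
    LinearMap.mk₂ k (fun u g => t (T.tr x (g ≫ u))) (fun u u' g => by simp)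
      (fun c u g => by simp) (fun u g g' => by simp) (fun c u g => by simp)
  have hP : P.IsPerfPair := LinearMap.IsPerfPair.of_injective'
    ((injective_iff_map_eq_zero P).2 fun u h0 => ht _ _ u fun g => by
      rw [← T.comm]
      exact LinearMap.congr_fun h0 g)
    ((injective_iff_map_eq_zero P.flip).2 fun g h0 => ht _ _ g fun u => LinearMap.congr_fun h0 u)
  obtain ⟨u, rfl⟩ := hP.bijective_left.2 φ
  obtain ⟨η, rfl⟩ := exists_eq_shift_comp h u
  exact ⟨η, fun g => by rw [deg_comp]; rfl⟩

end Nondegenerate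

end ShiftTrace

end ShiftTrace

/-! ### Sign rules for powers and the graded center -/

section GradedCenter

variable {C : Type v} [Category.{w} C] [HasShift C ℤ]

lemma shiftedHom_comp_assoc {a₁ a₂ a₃ a₁₂ a₂₃ a : ℤ} {x y z z' : C} (α : ShiftedHom x y a₁)
    (β : ShiftedHom y z a₂) (γ : ShiftedHom z z' a₃) (h₁₂ : a₂ + a₁ = a₁₂) (h₂₃ : a₃ + a₂ = a₂₃)
    (h : a₃ + a₁₂ = a) (h' : a₂₃ + a₁ = a) :
    (α.comp β h₁₂).comp γ h = α.comp (β.comp γ h₂₃) h' :=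
  ShiftedHom.comp_assoc α β γ h₁₂ h₂₃ (by omega)

variable [Preadditive C]

lemma shiftedHom_units_smul_comp {a b c : ℤ} {x y z : C} (ε : ℤˣ) (α : ShiftedHom x y a)
    (β : ShiftedHom y z b) (h : b + a = c) : (ε • α).comp β h = ε • α.comp β h := by
  rcases Int.units_eq_one_or ε with rfl | rfl <;> simp

variable {n : ℤ} {η : ∀ x : C, ShiftedHom x x n} (hη : η ∈ gradedCenter C n)

include hη in
lemma gradedCenter_comp {x y : C} {j s : ℤ} (f : ShiftedHom x y j) (h₁ : j + n = s)
    (h₂ : n + j = s) : (η x).comp f h₁ = (n * j).negOnePow • f.comp (η y) h₂ := by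
  subst h₁
  exact hη x y j f

variable [∀ n : ℤ, (shiftFunctor C n).Additive]

lemma shiftedHom_comp_units_smul {a b c : ℤ} {x y z : C} (ε : ℤˣ) (α : ShiftedHom x y a)
    (β : ShiftedHom y z b) (h : b + a = c) : α.comp (ε • β) h = ε • α.comp β h := by
  rcases Int.units_eq_one_or ε with rfl | rfl <;> simp

include hη

lemma endPow_gradedCenter_comp (m : ℕ) {x y : C} {j s : ℤ} (f : ShiftedHom x y j)
    (h₁ : j + m * n = s) (h₂ : m * n + j = s) :
    (endPow (η x) m).comp f h₁ = (m * n * j).negOnePow • f.comp (endPow (η y) m) h₂ := by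
  induction m generalizing s with
  | zero =>
    obtain rfl : s = j := by simpa using h₁.symm
    rw [endPow, endPow, ShiftedHom.mk₀_id_comp _ (by simp), ShiftedHom.comp_mk₀_id _ _ (by simp)]
    simp
  | succ m ih =>
    have e : ((m + 1 : ℕ) : ℤ) * n = m * n + n := by push_cast; ring
    rw [endPow, endPow, shiftedHom_comp_assoc _ _ _ _ rfl _ (by rw [← h₁, e]; ring),
      ih rfl (add_comm _ _), shiftedHom_comp_units_smul,
      ← shiftedHom_comp_assoc _ _ _ rfl _ (by rw [← h₁, e]; ring),
      gradedCenter_comp hη _ _ (add_comm _ _), shiftedHom_units_smul_comp, smul_smul,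
      ← Int.negOnePow_add, shiftedHom_comp_assoc _ _ _ _ e.symm _ h₂]
    congr 2
    rw [e]
    ring

/-- Up to a sign that does not depend on `f`, powers are compatible with multiplication by an
element of the graded center. -/
lemma exists_endPow_comp_gradedCenter (m : ℕ) {j d : ℤ} (h : n + j = d) :
    ∃ ε : ℤˣ, ∀ (x : C) (f : ShiftedHom x x j) (h' : (m : ℤ) * n + m * j = m * d),
      endPow (f.comp (η x) h) m = ε • (endPow f m).comp (endPow (η x) m) h' := by
  induction m with
  | zero =>
    refine ⟨1, fun x f h' => ?_⟩
    rw [endPow, endPow, endPow, ShiftedHom.mk₀_comp_mk₀ _ _ _ (by simp) (by simp), one_smul,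
      Category.id_comp]
  | succ m ih =>
    obtain ⟨ε, hε⟩ := ih
    refine ⟨ε * (n * (m * j)).negOnePow, fun x f h' => ?_⟩
    have hd : (m : ℤ) * n + m * j = m * d := by rw [← h]; ring
    have en : ((m + 1 : ℕ) : ℤ) * n = m * n + n := by push_cast; ring
    have ej : ((m + 1 : ℕ) : ℤ) * j = m * j + j := by push_cast; ring
    have ed : ((m + 1 : ℕ) : ℤ) * d = m * d + d := by push_cast; ring
    rw [endPow, endPow, endPow, hε x f hd, shiftedHom_comp_units_smul,
      shiftedHom_comp_assoc _ _ _ _ (a₂₃ := m * d + n) rfl _ (by omega),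
      ← shiftedHom_comp_assoc _ _ _ (a₁₂ := m * j + n) rfl _ (by omega) (by omega),
      gradedCenter_comp hη _ _ (add_comm _ _), shiftedHom_units_smul_comp,
      shiftedHom_comp_assoc _ _ _ _ en.symm _ (by omega), shiftedHom_comp_units_smul, smul_smul,
      ← shiftedHom_comp_assoc _ _ _ ej.symm _ (by omega) (by omega)]

end GradedCenter

section DegreeZero

variable {C : Type v} [Category.{w} C] [HasShift C ℤ]

lemma endPow_mk₀ {x : C} {n : ℤ} (hn : n = 0) (e : End x) (m : ℕ) :
    endPow (ShiftedHom.mk₀ n hn (e : x ⟶ x)) m =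
      ShiftedHom.mk₀ _ (by rw [hn, mul_zero]) ((e ^ m : End x) : x ⟶ x) := by
  induction m with
  | zero => rfl
  | succ m ih =>
    rw [endPow, ih, ShiftedHom.mk₀_comp_mk₀, pow_succ]
    rfl

lemma exists_eq_mk₀ {x y : C} {n : ℤ} (hn : n = 0) (f : ShiftedHom x y n) :
    ∃ e : x ⟶ y, f = ShiftedHom.mk₀ n hn e :=
  ⟨_, ((ShiftedHom.homEquiv n hn).apply_symm_apply f).symm⟩

end DegreeZero

/-! ### Functionals on the abelianization, and the criterion for Külshammer ideals -/

section Loops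

variable {k : Type u} [Field k] {C : Type v} [Category.{w} C] [Preadditive C] [Linear k C]
  [HasShift C ℤ] {V : Type*} [AddCommGroup V] [Module k V]

open Classical in
lemma loops_mapRange_eq_sum {n m : ℤ} (e : ∀ x : C, ShiftedHom x x n → ShiftedHom x x m)
    (he : ∀ x, e x 0 = 0) (f : Loops C n) :
    (DFinsupp.mapRange e he f : Loops C m) =
      ∑ x ∈ DFinsupp.support f,
        DirectSum.of (fun z : C => ShiftedHom z z m) x (e x (f x)) := by
  refine (DirectSum.sum_support_of (β := fun z : C => ShiftedHom z z m) _).symm.trans ?_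
  simp only [DFinsupp.mapRange_apply]
  refine Finset.sum_subset DFinsupp.support_mapRange fun x _ hx => ?_
  rw [DFinsupp.mem_support_iff, not_not, DFinsupp.mapRange_apply] at hx
  rw [hx, map_zero]

open Classical in
lemma toModule_eq_zero_of_mem_commutators {n : ℤ} (ψ : ∀ x : C, ShiftedHom x x n →ₗ[k] V)
    (hψ : ∀ (x y : C) (i j : ℤ) (hij : j + i = n) (hji : i + j = n) (f : ShiftedHom x y i)
      (g : ShiftedHom y x j), ψ x (f.comp g hij) = (i * j).negOnePow • ψ y (g.comp f hji))
    {c : Loops C n} (hc : c ∈ commutators k C n) : DirectSum.toModule k C V ψ c = 0 := by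
  have : commutators k C n ≤ LinearMap.ker (DirectSum.toModule k C V ψ) := by
    refine Submodule.span_le.2 ?_
    rintro _ ⟨x, y, i, j, hij, hji, f, g, rfl⟩
    rw [SetLike.mem_coe, LinearMap.mem_ker, map_sub, Units.smul_def, map_zsmul, ← Units.smul_def,
      sub_eq_zero]
    refine (DirectSum.toModule_lof k x _).trans ((hψ x y i j hij hji f g).trans ?_)
    congr 1
    exact (DirectSum.toModule_lof k y _).symm
  exact this hc

variable {W : Type*} [AddCommGroup W] [Module k W] (T : ShiftTrace k C W) (t : W →ₗ[k] k)
  (ht : ∀ (x y : C) (u : x ⟶ y), (∀ g : y ⟶ x, t (T.tr x (u ≫ g)) = 0) → u = 0)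

include ht in
open Classical in
/-- Linear functionals on the abelianization of the orbit category are represented by elements of
the graded center. -/
lemma exists_gradedCenter_eq_deg_comp [∀ x y : C, FiniteDimensional k (x ⟶ y)] {n s : ℤ}
    (h : n + s = 0) (Φ : Loops C s →ₗ[k] k) (hΦ : ∀ c ∈ commutators k C s, Φ c = 0) :
    ∃ η ∈ gradedCenter C n, ∀ (x : C) (g : ShiftedHom x x s),
      Φ (DirectSum.of (fun z : C => ShiftedHom z z s) x g) = t (T.deg rfl x (g.comp (η x) h)) := by
  have hex := fun x : C => T.exists_eq_deg_comp t ht h x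
    (Φ ∘ₗ DirectSum.lof k C (fun z : C => ShiftedHom z z s) x)
  choose η hη using hex
  have hη' : ∀ (x : C) (g : ShiftedHom x x s),
      Φ (DirectSum.of (fun z : C => ShiftedHom z z s) x g) = t (T.deg rfl x (g.comp (η x) h)) := hη
  refine ⟨η, fun x y j f => ?_, hη'⟩
  -- Centrality may be tested by composing with g and tracing; it then becomes the vanishing of Φ on
  -- the graded commutator of f and g.
  refine T.eq_of_forall_deg_comp_eq t ht (m' := s - j) (by omega) _ _ fun g => ?_
  have h1 : s - j + j = s := by omega
  have h2 : j + (s - j) = s := by omega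
  have h3 : s + n = 0 := by omega
  have hc := hΦ _ (Submodule.subset_span ⟨x, y, j, s - j, h1, h2, f, g, rfl⟩)
  rw [map_sub, Units.smul_def, map_zsmul, ← Units.smul_def, sub_eq_zero, hη', hη'] at hc
  have hsm : ∀ (z : C) (ε : ℤˣ) (g : ShiftedHom z z (0 : ℤ)),
      t (T.deg rfl z (ε • g)) = ε • t (T.deg rfl z g) := fun z ε g => by
    rw [Units.smul_def, Units.smul_def, map_zsmul, map_zsmul]
  have hcomm : ∀ {z z' : C} {a b : ℤ} (f : ShiftedHom z z' a) (g : ShiftedHom z' z b)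
      (h₁ : b + a = 0) (h₂ : a + b = 0),
      t (T.deg rfl z (f.comp g h₁)) = (a * b).negOnePow • t (T.deg rfl z' (g.comp f h₂)) := by
    intro z z' a b f g h₁ h₂
    rw [T.deg_comp_comm rfl f g h₁ h₂, Units.smul_def, map_zsmul, ← Units.smul_def]
  rw [shiftedHom_units_smul_comp, hsm, shiftedHom_comp_assoc (η x) f g rfl h1 _ h3,
    hcomm _ _ h3 h, hc, shiftedHom_comp_assoc f (η y) g _ (a₂₃ := s - j + n) rfl _ (by omega),
    hcomm f _ (by omega) (by omega), shiftedHom_comp_assoc (η y) g f _ h2 _ h3, hcomm (η y) _ h3 h,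
    smul_smul, smul_smul, smul_smul, ← Int.negOnePow_add, ← Int.negOnePow_add,
    ← Int.negOnePow_add]
  congr 1
  rw [Int.negOnePow_eq_iff]
  obtain rfl : n = -s := by omega
  exact ⟨j * s, by ring⟩

lemma iterate_map_sum {F : W →+ W} {ι : Type*} (S : Finset ι) (w : ι → W) (r : ℕ) :
    F^[r] (∑ i ∈ S, w i) = ∑ i ∈ S, F^[r] (w i) := by
  induction r generalizing w with
  | zero => rfl
  | succ r ih => simp only [Function.iterate_succ_apply, map_sum, ih]

section Main

variable (p : ℕ) (F : W →+ W)
  (hF : ∀ (x : C) (e : End x), T.tr x ((e ^ p : End x) : x ⟶ x) = F (T.tr x e))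
  (χ : ∀ x : C, x ⟶ x)
  (hχ : (fun x => ShiftedHom.mk₀ (0 : ℤ) rfl (χ x)) ∈ gradedCenter C 0)
  (A : W →ₗ[k] W) (hA : ∀ (x : C) (e : x ⟶ x), T.tr x (e ≫ χ x) = A (T.tr x e))

include hF in
lemma tr_pow_eq_iterate (r : ℕ) (x : C) (e : End x) :
    T.tr x ((e ^ p ^ r : End x) : x ⟶ x) = F^[r] (T.tr x e) := by
  induction r generalizing e with
  | zero => simp
  | succ r ih => rw [Function.iterate_succ_apply, ← hF, ← ih, ← pow_mul, ← pow_succ']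

variable [NeZero p] [∀ n : ℤ, (shiftFunctor C n).Additive]

include ht hF hχ hA in
open Classical in
-- A functional Φ separating χf from the commutators is tr(· η) with η central. The total trace of
-- the degree zero loops f_x η_x is killed by F^r, and `hrA` then forces Φ(χf) = 0.
lemma leftMul_mem_commutators [∀ x y : C, FiniteDimensional k (x ⟶ y)] (r : ℕ)
    (hrA : ∀ w, F^[r] w = 0 → t (A w) = 0) {m s : ℤ} (h : 0 + m = s) (f : Loops C m)
    (hf : f ∈ kernelPow k C p r m) :
    leftMul h (fun x => ShiftedHom.mk₀ (0 : ℤ) rfl (χ x)) f ∈ commutators k C s := by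
  obtain rfl : m = s := by omega
  by_contra hcon
  obtain ⟨Φ, hΦf, hΦ⟩ := Submodule.exists_le_ker_of_notMem hcon
  have hnm : -m + m = 0 := by omega
  obtain ⟨η, hη, hΦη⟩ := exists_gradedCenter_eq_deg_comp T t ht hnm Φ fun c hc => hΦ hc
  have he : ∀ x, ∃ e : x ⟶ x, (f x).comp (η x) hnm = ShiftedHom.mk₀ 0 rfl e :=
    fun x => exists_eq_mk₀ rfl _
  choose e he using he
  apply hΦf
  have h1 : Φ (leftMul h (fun x => ShiftedHom.mk₀ (0 : ℤ) rfl (χ x)) f) =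
      t (A (∑ x ∈ DFinsupp.support f, T.tr x (e x))) := by
    rw [leftMul, loops_mapRange_eq_sum, map_sum, map_sum, map_sum]
    refine Finset.sum_congr rfl fun x _ => ?_
    rw [hΦη, ← hA, shiftedHom_comp_assoc _ _ _ _ (add_zero _) _ hnm,
      gradedCenter_comp hχ _ _ (zero_add _),
      zero_mul, Int.negOnePow_zero, one_smul,
      ← shiftedHom_comp_assoc _ _ _ hnm _ (zero_add _), he, ShiftedHom.mk₀_comp_mk₀,
      T.deg_mk₀]
  rw [h1]
  refine hrA _ ?_
  obtain ⟨ε, hε⟩ := exists_endPow_comp_gradedCenter hη (p ^ r) hnm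
  have hd : ((p ^ r : ℕ) : ℤ) * (-m) + (p ^ r : ℕ) * m = (p ^ r : ℕ) * 0 := by ring
  have h0 : ((p ^ r : ℕ) : ℤ) * 0 = 0 := mul_zero _
  -- Since η^(p^r) is graded central, tracing after multiplication by it kills graded commutators,
  -- in particular f^(p^r).
  let ψ : ∀ x : C, ShiftedHom x x (((p ^ r : ℕ) : ℤ) * m) →ₗ[k] W := fun x =>
    T.deg h0 x ∘ₗ
      { toFun := fun g => g.comp (endPow (η x) (p ^ r)) hd
        map_add' := fun g g' => ShiftedHom.add_comp _ _ _ _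
        map_smul' := fun c g => ShiftedHom.smul_comp _ _ _ _ }
  have hψ0 : DirectSum.toModule k C W ψ (loopPow C (p ^ r) f) = 0 := by
    refine toModule_eq_zero_of_mem_commutators ψ ?_ hf
    intro x y i j hij hji f g
    change T.deg h0 x ((f.comp g hij).comp (endPow (η x) (p ^ r)) hd) =
      _ • T.deg h0 y ((g.comp f hji).comp (endPow (η y) (p ^ r)) hd)
    rw [shiftedHom_comp_assoc f g _ _ rfl _ (by rw [← hd, ← hij]; ring),
      T.deg_comp_comm h0 _ _ _ (by rw [← hd, ← hij]; ring),
      shiftedHom_comp_assoc g _ f _ rfl _ (by rw [← hd, ← hij]; ring),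
      endPow_gradedCenter_comp hη _ f rfl (add_comm _ _), shiftedHom_comp_units_smul,
      ← shiftedHom_comp_assoc g f _ hji _ hd, Units.smul_def, Units.smul_def, map_zsmul,
      ← Units.smul_def, ← Units.smul_def, smul_smul, ← Int.negOnePow_add]
    congr 1
    rw [Int.negOnePow_eq_iff]
    exact ⟨i * ((p ^ r : ℕ) * -m), by ring⟩
  rw [iterate_map_sum]
  -- The sign ε is the same for all objects, so it can be pulled out of the sum over x.
  have h2 : ∀ x, F^[r] (T.tr x (e x)) = ε • ψ x (endPow (f x) (p ^ r)) := by
    intro x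
    rw [← tr_pow_eq_iterate T p F hF, ← T.deg_mk₀ h0, ← endPow_mk₀ rfl, ← he, hε _ _ hd,
      Units.smul_def, map_zsmul, ← Units.smul_def]
    rfl
  rw [loopPow, loops_mapRange_eq_sum, map_sum] at hψ0
  simp only [h2]
  rw [← Finset.smul_sum, ← hψ0]
  have h3 : ∀ x, DirectSum.toModule k C W ψ
      (DirectSum.of (fun z : C => ShiftedHom z z _) x (endPow (f x) (p ^ r))) =
        ψ x (endPow (f x) (p ^ r)) := fun x => DirectSum.toModule_lof k x _
  simp only [h3] at hψ0 ⊢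
  rw [hψ0, smul_zero]

include ht hF hχ hA in
theorem mk₀_mem_kuelshammerIdeal [∀ x y : C, FiniteDimensional k (x ⟶ y)] (r : ℕ)
    (hrA : ∀ w, F^[r] w = 0 → t (A w) = 0) :
    (fun x => ShiftedHom.mk₀ (0 : ℤ) rfl (χ x)) ∈ kuelshammerIdeal k C p r 0 := by
  refine Set.mem_iInter.2 fun s => ⟨hχ, fun f hf => ?_⟩
  have h1 := leftMul_mem_commutators T t ht p F hF χ hχ A hA r hrA (add_sub_cancel 0 s) f hf
  refine ⟨h1, ?_⟩
  convert h1 using 1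
  refine DFinsupp.ext fun x => ?_
  rw [rightMul, leftMul, DFinsupp.mapRange_apply, DFinsupp.mapRange_apply,
    gradedCenter_comp hχ _ _ (add_sub_cancel 0 s), zero_mul, Int.negOnePow_zero, one_smul]

end Main

end Loops

section Category

variable {C : Type*} [Category* C]

lemma eq_comp_comp_inv {x y : C} (e : x ≅ y) {f : x ⟶ x} {g : y ⟶ y}
    (h : f ≫ e.hom = e.hom ≫ g) : f = e.hom ≫ g ≫ e.inv := by
  rw [← Category.assoc, ← h, Category.assoc, e.hom_inv_id, Category.comp_id]

lemma comp_comp_eq_of_comm {x y z : C} {a : x ⟶ y} {b : y ⟶ z} {f : x ⟶ x} {g : y ⟶ y} {h : z ⟶ z}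
    (ha : f ≫ a = a ≫ g) (hb : g ≫ b = b ≫ h) : f ≫ a ≫ b = (a ≫ b) ≫ h := by
  rw [reassoc_of% ha, hb, Category.assoc]

end Category

/-! ### The supertrace on the homotopy category -/

section PerfectTrace

variable (k : Type*) [Field k] {Γ : Type v} [Ring Γ] [Algebra k Γ]

lemma isPerfectComplex_shift {K : CochainComplex (ModuleCat.{v} Γ) ℤ} (hK : isPerfectComplex Γ K)
    (n : ℤ) : isPerfectComplex Γ (K⟦n⟧) := by
  obtain ⟨⟨a, b, hab⟩, hfp⟩ := hK
  exact ⟨⟨a - n, b - n, fun i hi => hab (i + n) (by omega)⟩, fun i => hfp (i + n)⟩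

lemma PerfectCat.isPerfectComplex_as (x : PerfectCat Γ) : isPerfectComplex Γ x.obj.as := by
  obtain ⟨⟨_⟩, ⟨K, hK⟩⟩ := x
  exact hK

lemma strace_eq_of_quotient_map_eq {K : CochainComplex (ModuleCat.{v} Γ) ℤ}
    (hK : isPerfectComplex Γ K) {φ ψ : K ⟶ K}
    (h : (HomotopyCategory.quotient _ (ComplexShape.up ℤ)).map φ =
      (HomotopyCategory.quotient _ _).map ψ) : strace k φ = strace k ψ :=
  strace_eq_of_homotopy k hK (HomotopyCategory.homotopyOfEq _ _ h)

lemma PerfectCat.exists_quotient_map_eq {x y : PerfectCat Γ} (f : x ⟶ y) :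
    ∃ φ : x.obj.as ⟶ y.obj.as, f.hom = (HomotopyCategory.quotient _ _).map φ :=
  ⟨f.hom.out, (HomotopyCategory.quotient_map_out _).symm⟩

/-- The supertrace of an endomorphism in the homotopy category of perfect complexes. -/
noncomputable def perfectTr (x : PerfectCat Γ) (f : x ⟶ x) : CommQuot k Γ :=
  strace k (PerfectCat.exists_quotient_map_eq f).choose

lemma perfectTr_eq_strace {x : PerfectCat Γ} (f : x ⟶ x) (φ : x.obj.as ⟶ x.obj.as)
    (h : f.hom = (HomotopyCategory.quotient _ _).map φ) : perfectTr k x f = strace k φ :=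
  strace_eq_of_quotient_map_eq k x.isPerfectComplex_as
    ((PerfectCat.exists_quotient_map_eq f).choose_spec.symm.trans h)

/-- Traces are invariant under conjugation. This is applied to the shift of an object, compared with
the shifted complex through the commutation isomorphisms. -/
lemma perfectTr_eq_strace_of_iso {x : PerfectCat Γ} {K : CochainComplex (ModuleCat.{v} Γ) ℤ}
    (hK : isPerfectComplex Γ K) (e : x.obj ≅ (HomotopyCategory.quotient _ _).obj K) (f : x ⟶ x)
    (φ : K ⟶ K) (h : f.hom ≫ e.hom = e.hom ≫ (HomotopyCategory.quotient _ _).map φ) :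
    perfectTr k x f = strace k φ := by
  let Q := HomotopyCategory.quotient (ModuleCat.{v} Γ) (ComplexShape.up ℤ)
  obtain ⟨a, ha⟩ := Q.map_surjective (X := x.obj.as) e.hom
  obtain ⟨b, hb⟩ := Q.map_surjective (Y := x.obj.as) e.inv
  have hba : Q.map (b ≫ a) = 𝟙 _ := by
    rw [Q.map_comp, ha, hb]
    exact e.inv_hom_id
  rw [perfectTr_eq_strace k f (a ≫ φ ≫ b), strace_comp_comm k x.isPerfectComplex_as hK]
  · refine strace_eq_of_quotient_map_eq k hK ?_
    rw [Category.assoc, Functor.map_comp, hba, Category.comp_id]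
  · change f.hom = Q.map _
    rw [Q.map_comp, Q.map_comp, ha, hb]
    exact eq_comp_comp_inv e h

variable (Γ) in
/-- The supertrace on the homotopy category of perfect complexes. -/
noncomputable def perfectTrace : ShiftTrace k (PerfectCat Γ) (CommQuot k Γ) where
  tr x :=
    { toFun := perfectTr k x
      map_add' f g := by
        obtain ⟨φ, hφ⟩ := PerfectCat.exists_quotient_map_eq f
        obtain ⟨ψ, hψ⟩ := PerfectCat.exists_quotient_map_eq g
        rw [perfectTr_eq_strace k f φ hφ, perfectTr_eq_strace k g ψ hψ,
          ← strace_add k x.isPerfectComplex_as]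
        refine perfectTr_eq_strace k _ _ ?_
        rw [Functor.map_add, ← hφ, ← hψ]
        rfl
      map_smul' c f := by
        obtain ⟨φ, hφ⟩ := PerfectCat.exists_quotient_map_eq f
        rw [perfectTr_eq_strace k f φ hφ, RingHom.id_apply, ← strace_smul]
        refine perfectTr_eq_strace k _ _ ?_
        rw [Functor.map_smul, ← hφ]
        rfl }
  comm {x y} f g := by
    obtain ⟨φ, hφ⟩ := PerfectCat.exists_quotient_map_eq f
    obtain ⟨ψ, hψ⟩ := PerfectCat.exists_quotient_map_eq g
    change perfectTr k x _ = perfectTr k y _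
    rw [perfectTr_eq_strace k (f ≫ g) (φ ≫ ψ), perfectTr_eq_strace k (g ≫ f) (ψ ≫ φ),
      strace_comp_comm k x.isPerfectComplex_as y.isPerfectComplex_as]
    · rw [Functor.map_comp, ← hφ, ← hψ]
      rfl
    · rw [Functor.map_comp, ← hφ, ← hψ]
      rfl
  shift {x} f n := by
    obtain ⟨φ, hφ⟩ := PerfectCat.exists_quotient_map_eq f
    let Q := HomotopyCategory.quotient (ModuleCat.{v} Γ) (ComplexShape.up ℤ)
    change perfectTr k (x⟦n⟧) _ = _ • perfectTr k x _
    rw [perfectTr_eq_strace k f φ hφ, ← strace_shift k x.isPerfectComplex_as]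
    refine perfectTr_eq_strace_of_iso k (isPerfectComplex_shift x.isPerfectComplex_as n)
      (((isPerfect Γ).ι.commShiftIso n).app x ≪≫ (Q.commShiftIso n).symm.app x.obj.as) _ _ ?_
    have h1 := ((isPerfect Γ).ι.commShiftIso n).hom.naturality f
    have h2 := (Q.commShiftIso n).inv.naturality φ
    change _ = _ ≫ f.hom⟦n⟧' at h1
    rw [hφ] at h1
    exact comp_comp_eq_of_comm h1 h2

lemma perfectTrace_tr {x : PerfectCat Γ} (f : x ⟶ x) (φ : x.obj.as ⟶ x.obj.as)
    (h : f.hom = (HomotopyCategory.quotient _ _).map φ) :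
    (perfectTrace k Γ).tr x f = strace k φ :=
  perfectTr_eq_strace k f φ h

lemma perfectTrace_tr_pow (p : ℕ) [Fact p.Prime] [CharP k p] (x : PerfectCat Γ) (e : End x) :
    (perfectTrace k Γ).tr x ((e ^ p : End x) : x ⟶ x) =
      frob k Γ p ((perfectTrace k Γ).tr x e) := by
  obtain ⟨φ, hφ⟩ := PerfectCat.exists_quotient_map_eq (e : x ⟶ x)
  let ψ : End x.obj.as := φ
  rw [perfectTrace_tr k e ψ hφ, ← strace_pow_char k p x.isPerfectComplex_as]
  refine perfectTrace_tr k _ _ ?_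
  have : ∀ m : ℕ, (InducedCategory.Hom.hom ((e ^ m : End x) : x ⟶ x)) =
      (HomotopyCategory.quotient _ _).map ((ψ ^ m : End x.obj.as) : x.obj.as ⟶ x.obj.as) := by
    intro m
    induction m with
    | zero => exact ((HomotopyCategory.quotient _ _).map_id _).symm
    | succ m ih =>
      rw [pow_succ, pow_succ]
      refine Eq.trans ?_ ((HomotopyCategory.quotient _ _).map_comp φ _).symm
      rw [← ih, ← hφ]
      rfl
  exact this p

variable [FiniteDimensional k Γ]

instance (x y : PerfectCat Γ) : FiniteDimensional k (x ⟶ y) := by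
  have := finiteDimensional_hom k x.isPerfectComplex_as y.isPerfectComplex_as
  let l : (x.obj.as ⟶ y.obj.as) →ₗ[k] (x ⟶ y) :=
    { toFun := fun φ => ObjectProperty.homMk ((HomotopyCategory.quotient _ _).map φ)
      map_add' := fun φ ψ => by
        rw [Functor.map_add]
        rfl
      map_smul' := fun c φ => by
        rw [Functor.map_smul]
        rfl }
  refine Module.Finite.of_surjective l fun f => ?_
  obtain ⟨φ, hφ⟩ := PerfectCat.exists_quotient_map_eq f
  exact ⟨φ, InducedCategory.hom_ext hφ.symm⟩

variable {k} in
lemma eq_zero_of_traceForm_perfectTrace {B : LinearMap.BilinForm k Γ} (hB : IsSymmetrizingForm B)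
    (x y : PerfectCat Γ) (u : x ⟶ y)
    (hu : ∀ g : y ⟶ x, hB.traceForm ((perfectTrace k Γ).tr x (u ≫ g)) = 0) : u = 0 := by
  obtain ⟨φ, hφ⟩ := PerfectCat.exists_quotient_map_eq u
  obtain ⟨h⟩ := nonempty_homotopy_zero_of_traceForm_strace_eq_zero hB x.isPerfectComplex_as
    y.isPerfectComplex_as φ fun g => by
      rw [strace_comp_comm k y.isPerfectComplex_as x.isPerfectComplex_as,
        ← hu (ObjectProperty.homMk ((HomotopyCategory.quotient _ _).map g)),
        perfectTrace_tr k _ (φ ≫ g)]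
      rw [Functor.map_comp, ← hφ]
      rfl
  refine InducedCategory.hom_ext ?_
  rw [hφ, HomotopyCategory.eq_of_homotopy _ _ h, Functor.map_zero]
  rfl

end PerfectTrace

/-! ### The action of the center on perfect complexes -/

section Characteristic

variable {k : Type*} [Field k] {Λ : Type v} [Ring Λ] [Algebra k Λ] (a : Subalgebra.center k Λ)

lemma centerMulHomotopy_naturality {X Y : HomotopyCategory (ModuleCat.{v} Λᵐᵒᵖ) (ComplexShape.up ℤ)}
    (f : X ⟶ Y) : centerMulHomotopy a X ≫ f = f ≫ centerMulHomotopy a Y := by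
  obtain ⟨φ, rfl⟩ := (HomotopyCategory.quotient _ _).map_surjective (X := X.as) (Y := Y.as) f
  refine ((HomotopyCategory.quotient _ _).map_comp _ _).symm.trans
    (Eq.trans ?_ ((HomotopyCategory.quotient _ _).map_comp _ _))
  congr 1
  ext i x
  exact (φ.f i).hom.map_smul (MulOpposite.op (a : Λ)) x

lemma shift_centerMulHomotopy (X : HomotopyCategory (ModuleCat.{v} Λᵐᵒᵖ) (ComplexShape.up ℤ))
    (n : ℤ) : (centerMulHomotopy a X)⟦n⟧' = centerMulHomotopy a (X⟦n⟧) := by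
  let Q := HomotopyCategory.quotient (ModuleCat.{v} Λᵐᵒᵖ) (ComplexShape.up ℤ)
  have h1 := (Q.commShiftIso n).hom.naturality (centerMulComplex a X.as)
  have h2 := centerMulHomotopy_naturality a ((Q.commShiftIso n).hom.app X.as)
  exact (cancel_epi ((Q.commShiftIso n).hom.app X.as)).1 (h1.symm.trans h2)

/-- Multiplication by a central element of `Λ` on a perfect complex. -/
noncomputable def centerMulPerfect (x : PerfectCat Λᵐᵒᵖ) : x ⟶ x :=
  ObjectProperty.homMk (centerMulHomotopy a x.obj)

lemma shift_centerMulPerfect (x : PerfectCat Λᵐᵒᵖ) (n : ℤ) :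
    (centerMulPerfect a x)⟦n⟧' = centerMulPerfect a (x⟦n⟧) := by
  have h1 := ((isPerfect Λᵐᵒᵖ).ι.commShiftIso n).hom.naturality (centerMulPerfect a x)
  have h2 := centerMulHomotopy_naturality a (((isPerfect Λᵐᵒᵖ).ι.commShiftIso n).hom.app x)
  refine (isPerfect Λᵐᵒᵖ).ι.map_injective ?_
  rw [← cancel_mono (((isPerfect Λᵐᵒᵖ).ι.commShiftIso n).hom.app x)]
  refine h1.trans (Eq.trans ?_ h2.symm)
  congr 1
  exact shift_centerMulHomotopy a x.obj n

lemma characteristicZero_mem_gradedCenter :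
    characteristicZero a ∈ gradedCenter (PerfectCat Λᵐᵒᵖ) 0 := by
  intro x y j f
  rw [zero_mul, Int.negOnePow_zero, one_smul]
  have h : centerMulPerfect a x ≫ f = f ≫ (centerMulPerfect a y)⟦j⟧' := by
    rw [shift_centerMulPerfect]
    exact InducedCategory.hom_ext (centerMulHomotopy_naturality a f.hom)
  have key : ∀ (s : ℤ) (h₁ : j + 0 = s) (h₂ : 0 + j = s),
      (characteristicZero a x).comp f h₁ = f.comp (characteristicZero a y) h₂ := by
    intro s h₁ h₂
    obtain rfl : s = j := by omega
    exact (ShiftedHom.mk₀_comp (0 : ℤ) rfl (centerMulPerfect a x) f).trans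
      (h.trans (ShiftedHom.comp_mk₀ f (0 : ℤ) rfl (centerMulPerfect a y)).symm)
  exact key _ rfl _

lemma op_mem_center (a : Subalgebra.center k Λ) :
    MulOpposite.op (a : Λ) ∈ Subalgebra.center k Λᵐᵒᵖ :=
  Subalgebra.mem_center_iff.2 fun b => MulOpposite.unop_injective (by
    simpa using (Subalgebra.mem_center_iff.mp a.2 b.unop).symm)

lemma perfectTrace_comp_centerMulPerfect (x : PerfectCat Λᵐᵒᵖ) (e : x ⟶ x) :
    (perfectTrace k Λᵐᵒᵖ).tr x (e ≫ centerMulPerfect a x) =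
      centerAct k (MulOpposite.op (a : Λ)) (op_mem_center a) ((perfectTrace k Λᵐᵒᵖ).tr x e) := by
  obtain ⟨φ, hφ⟩ := PerfectCat.exists_quotient_map_eq e
  rw [perfectTrace_tr k e φ hφ, perfectTrace_tr k _ (φ ≫ centerMulComplex a x.obj.as)]
  · exact strace_eq_centerAct k x.isPerfectComplex_as _ _ _ _ fun i x => rfl
  · rw [Functor.map_comp, ← hφ]
    rfl

end Characteristic

/-! ### The regular module as a test object -/

section Regular

variable (Γ : Type v) [Ring Γ]

/-- The regular module, as a complex concentrated in degree zero. -/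
noncomputable def regularComplex : CochainComplex (ModuleCat.{v} Γ) ℤ :=
  (HomologicalComplex.single _ _ 0).obj (ModuleCat.of Γ Γ)

lemma isPerfectComplex_regularComplex : isPerfectComplex Γ (regularComplex Γ) := by
  have h0 : ∀ i : ℤ, i ≠ 0 → Subsingleton ((regularComplex Γ).X i) := fun i hi =>
    ModuleCat.subsingleton_of_isZero (HomologicalComplex.isZero_single_obj_X _ _ _ _ hi)
  refine ⟨⟨0, 0, fun i hi => h0 i (by omega)⟩, fun i => ?_⟩
  by_cases hi : i = 0
  · subst hi
    let e := (HomologicalComplex.singleObjXSelf (ComplexShape.up ℤ) 0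
      (ModuleCat.of Γ Γ)).toLinearEquiv
    exact ⟨Module.Finite.equiv e.symm, Module.Projective.of_equiv e.symm⟩
  · have := h0 i hi
    exact ⟨inferInstance, inferInstance⟩

/-- The regular module, as a perfect complex. -/
noncomputable def regular : PerfectCat Γ :=
  ⟨(HomotopyCategory.quotient _ _).obj (regularComplex Γ),
    ⟨_, isPerfectComplex_regularComplex Γ⟩⟩

variable {Γ}

/-- Right multiplication by an element on the regular module, as a map of complexes. -/
noncomputable def rightMulComplex (b : Γ) : regularComplex Γ ⟶ regularComplex Γ :=
  (HomologicalComplex.single _ _ 0).map (ModuleCat.ofHom (LinearMap.toSpanSingleton Γ Γ b))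

lemma rightMulComplex_mul (a b : Γ) :
    rightMulComplex (a * b) = rightMulComplex a ≫ rightMulComplex b := by
  rw [rightMulComplex, rightMulComplex, rightMulComplex]
  refine Eq.trans ?_ (Functor.map_comp _ _ _)
  congr 1
  ext
  simp

lemma rightMulComplex_one : rightMulComplex (1 : Γ) = 𝟙 _ := by
  rw [rightMulComplex]
  refine Eq.trans ?_ (CategoryTheory.Functor.map_id _ _)
  congr 1
  ext
  simp

variable (k : Type*) [Field k] [Algebra k Γ]

lemma strace_rightMulComplex (b : Γ) : strace k (rightMulComplex b) = cls k b := by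
  have hK := isPerfectComplex_regularComplex Γ
  have : Module.Finite Γ (((HomologicalComplex.single (ModuleCat.{v} Γ)
    (ComplexShape.up ℤ) 0).obj (ModuleCat.of Γ Γ)).X 0) := (hK.2 0).1
  have : Module.Projective Γ (((HomologicalComplex.single (ModuleCat.{v} Γ)
    (ComplexShape.up ℤ) 0).obj (ModuleCat.of Γ Γ)).X 0) := (hK.2 0).2
  rw [strace, finsum_eq_single _ 0]
  · rw [Int.negOnePow_zero, one_smul, rightMulComplex, HomologicalComplex.single_map_f_self]
    refine (htr_hom_comp_comm k (HomologicalComplex.singleObjXSelf (ComplexShape.up ℤ) 0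
      (ModuleCat.of Γ Γ)).hom _).trans ?_
    rw [Category.assoc, Iso.inv_hom_id, Category.comp_id]
    have key : ∀ (M : ModuleCat.{v} Γ) [Module.Finite Γ M] [Module.Projective Γ M]
        (s : M →ₗ[Γ] Γ) (y : M), htr k (s.smulRight y) = cls k (s y) := fun M _ _ => htr_smulRight k
    -- Right multiplication by b is the rank one map built from the identity functional and b.
    exact key (ModuleCat.of Γ Γ) LinearMap.id b
  · intro i hi
    have : Subsingleton ((regularComplex Γ).X i) :=
      ModuleCat.subsingleton_of_isZero (HomologicalComplex.isZero_single_obj_X _ _ _ _ hi)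
    rw [htr_eq_zero_of_subsingleton, smul_zero]

variable (Γ) in
/-- Right multiplication by an element on the regular module, in the homotopy category. -/
noncomputable def rightMulRegular : Γ →ₗ[k] (regular Γ ⟶ regular Γ) where
  toFun b := ObjectProperty.homMk ((HomotopyCategory.quotient _ _).map (rightMulComplex b))
  map_add' a b := by
    have : rightMulComplex (a + b) = rightMulComplex a + rightMulComplex b := by
      refine Eq.trans ?_ (Functor.map_add _)
      rw [rightMulComplex]
      congr 1
      ext
      simp
    rw [this, Functor.map_add]
    rfl
  map_smul' c b := by
    have : rightMulComplex (c • b) = c • rightMulComplex b := by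
      refine HomologicalComplex.from_single_hom_ext ?_
      have key : ∀ {X Y : ModuleCat.{v} Γ} (e : X ≅ Y) (f f' : Y ⟶ Y),
          (∀ y, f' y = algebraMap k Γ c • f y) →
            e.hom ≫ f' ≫ e.inv = c • (e.hom ≫ f ≫ e.inv) := fun e f f' h => by
        obtain rfl : f' = c • f := by
          ext y
          exact h y
        rw [Linear.smul_comp, Linear.comp_smul]
      refine (HomologicalComplex.single_map_f_self _ _ _).trans (Eq.trans ?_
        (congrArg (c • ·) (HomologicalComplex.single_map_f_self _ _ _).symm))
      refine key _ _ _ fun y => ?_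
      change y * (c • b) = algebraMap k Γ c * (y * b)
      rw [mul_smul_comm, Algebra.smul_def]
    rw [this, Functor.map_smul]
    rfl

lemma rightMulRegular_mul (a b : Γ) :
    rightMulRegular Γ k (a * b) = rightMulRegular Γ k a ≫ rightMulRegular Γ k b :=
  InducedCategory.hom_ext ((congrArg (HomotopyCategory.quotient _ _).map
    (rightMulComplex_mul a b)).trans (Functor.map_comp _ _ _))

lemma rightMulRegular_pow (b : Γ) (e : End (regular Γ)) (he : e = rightMulRegular Γ k b) (m : ℕ) :
    rightMulRegular Γ k (b ^ m) = (e ^ m : End (regular Γ)) := by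
  induction m with
  | zero =>
    rw [pow_zero, pow_zero]
    exact InducedCategory.hom_ext
      ((congrArg (HomotopyCategory.quotient _ _).map rightMulComplex_one).trans
        (CategoryTheory.Functor.map_id _ _))
  | succ m ih =>
    rw [pow_succ', rightMulRegular_mul, ih, pow_succ, ← he]
    rfl

lemma perfectTrace_rightMulRegular (b : Γ) :
    (perfectTrace k Γ).tr _ (rightMulRegular Γ k b) = cls k b :=
  (perfectTrace_tr k (rightMulRegular Γ k b) (rightMulComplex b) rfl).trans
    (strace_rightMulComplex k b)

open Classical in
-- The degree stays a variable because it is used for p^r·(0 - 0), which equals zero but is not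
-- literally 0.
lemma of_rightMulRegular_mem_commutators {n : ℤ} (hn : n = 0) {c : Γ}
    (hc : c ∈ commutatorSpace k Γ) :
    DirectSum.of (fun z : PerfectCat Γ => ShiftedHom z z n) (regular Γ)
      (ShiftedHom.mk₀ n hn (rightMulRegular Γ k c)) ∈ commutators k (PerfectCat Γ) n := by
  let L : Γ →ₗ[k] Loops (PerfectCat Γ) n :=
    DirectSum.lof k _ (fun z : PerfectCat Γ => ShiftedHom z z n) (regular Γ) ∘ₗ
      Linear.rightComp k _ ((shiftFunctorZero' _ n hn).inv.app _) ∘ₗ rightMulRegular Γ k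
  have h : commutatorSpace k Γ ≤ (commutators k (PerfectCat Γ) n).comap L := by
    refine Submodule.span_le.2 ?_
    rintro _ ⟨a, b, rfl⟩
    refine Submodule.subset_span ⟨regular Γ, regular Γ, n, n, by omega, by omega,
      ShiftedHom.mk₀ n hn (rightMulRegular Γ k a), ShiftedHom.mk₀ n hn (rightMulRegular Γ k b), ?_⟩
    rw [ShiftedHom.mk₀_comp_mk₀, ShiftedHom.mk₀_comp_mk₀, ← rightMulRegular_mul,
      ← rightMulRegular_mul, map_sub]
    have : (n * n).negOnePow = 1 := by rw [hn]; rfl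
    rw [this, one_smul]
    rfl
  exact h hc

end Regular

section Loops

variable {C : Type*} [Category* C] [Preadditive C] [HasShift C ℤ]

open Classical in
lemma leftMul_of {n m s : ℤ} (h : n + m = s) (η : ∀ x : C, ShiftedHom x x n) (x : C)
    (f : ShiftedHom x x m) :
    leftMul h η (DirectSum.of (fun z : C => ShiftedHom z z m) x f) =
      DirectSum.of (fun z : C => ShiftedHom z z s) x (f.comp (η x) h) :=
  DFinsupp.mapRange_single

variable [∀ n : ℤ, (shiftFunctor C n).Additive]

open Classical in
lemma loopPow_of (m : ℕ) [NeZero m] {n : ℤ} (x : C) (f : ShiftedHom x x n) :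
    loopPow C m (DirectSum.of (fun z : C => ShiftedHom z z n) x f) =
      DirectSum.of (fun z : C => ShiftedHom z z (m * n)) x (endPow f m) :=
  DFinsupp.mapRange_single

end Loops

/-! ### Comparison of the categorical and the classical ideals -/

section Main

variable {k : Type*} [Field k] {Λ : Type v} [Ring Λ] [Algebra k Λ]

/-- A symmetrizing form, seen on the opposite algebra. -/
def opForm (B : LinearMap.BilinForm k Λ) : LinearMap.BilinForm k Λᵐᵒᵖ :=
  B.compl₁₂ (MulOpposite.opLinearEquiv k).symm.toLinearMap
    (MulOpposite.opLinearEquiv k).symm.toLinearMap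

lemma IsSymmetrizingForm.opForm {B : LinearMap.BilinForm k Λ} (hB : IsSymmetrizingForm B) :
    IsSymmetrizingForm (opForm B) where
  nondegenerate :=
    ⟨fun x hx => MulOpposite.unop_injective (hB.nondegenerate.1 _ fun y => hx (MulOpposite.op y)),
      fun x hx => MulOpposite.unop_injective
        (hB.nondegenerate.2 _ fun y => hx (MulOpposite.op y))⟩
  assoc a b c := by
    change B (b.unop * a.unop) c.unop = B a.unop (c.unop * b.unop)
    exact (hB.symm _ _).trans ((hB.assoc _ _ _).symm.trans (hB.symm _ _))
  symm a b := hB.symm _ _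

variable (p : ℕ) [Fact p.Prime]

open Classical in
-- Multiplication by b on the regular module lies in the categorical kernel of the p^r-th power. Its
-- product with a is then a commutator, and the supertrace reads off that ab has class zero.
lemma op_mul_mem_commutatorSpace_of_characteristicZero_mem (a : Subalgebra.center k Λ) (r : ℕ)
    (h : characteristicZero a ∈ kuelshammerIdeal k (PerfectCat Λᵐᵒᵖ) p r 0) (b : Λᵐᵒᵖ)
    (hb : b ^ p ^ r ∈ commutatorSpace k Λᵐᵒᵖ) :
    MulOpposite.op (a : Λ) * b ∈ commutatorSpace k Λᵐᵒᵖ := by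
  have hf : DirectSum.of (fun z : PerfectCat Λᵐᵒᵖ => ShiftedHom z z ((0 : ℤ) - 0)) (regular Λᵐᵒᵖ)
      (ShiftedHom.mk₀ ((0 : ℤ) - 0) (sub_zero 0) (rightMulRegular Λᵐᵒᵖ k b)) ∈
      kernelPow k (PerfectCat Λᵐᵒᵖ) p r (0 - 0) := by
    have h1 := of_rightMulRegular_mem_commutators (n := ((p ^ r : ℕ) : ℤ) * (0 - 0)) k
      (by simp) hb
    rw [rightMulRegular_pow k b _ rfl, ← endPow_mk₀ (sub_zero 0)] at h1
    change loopPow (PerfectCat Λᵐᵒᵖ) _ _ ∈ commutators k (PerfectCat Λᵐᵒᵖ) _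
    rwa [loopPow_of]
  have h2 := ((Set.mem_iInter.1 h 0).2 _ hf).1
  have h3 : leftMul (add_sub_cancel 0 0) (characteristicZero a)
      (DirectSum.of (fun z : PerfectCat Λᵐᵒᵖ => ShiftedHom z z ((0 : ℤ) - 0)) (regular Λᵐᵒᵖ)
        (ShiftedHom.mk₀ _ (sub_zero 0) (rightMulRegular Λᵐᵒᵖ k b))) =
      DirectSum.of (fun z : PerfectCat Λᵐᵒᵖ => ShiftedHom z z (0 : ℤ)) (regular Λᵐᵒᵖ)
        (ShiftedHom.mk₀ 0 rfl (rightMulRegular Λᵐᵒᵖ k b ≫ centerMulPerfect a _)) := by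
    rw [leftMul_of, characteristicZero, ShiftedHom.mk₀_comp_mk₀]
    rfl
  rw [h3] at h2
  have h4 := toModule_eq_zero_of_mem_commutators (fun x => (perfectTrace k Λᵐᵒᵖ).deg rfl x)
    (fun x y i j hij hji f g => (perfectTrace k Λᵐᵒᵖ).deg_comp_comm rfl f g hij hji) h2
  replace h4 := (DirectSum.toModule_lof k (regular Λᵐᵒᵖ) _).symm.trans h4
  rw [ShiftTrace.deg_mk₀, perfectTrace_comp_centerMulPerfect, perfectTrace_rightMulRegular,
    centerAct_cls] at h4
  exact (Submodule.Quotient.mk_eq_zero _).1 h4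

variable [FiniteDimensional k Λ] [CharP k p]

theorem HK0_eq_idealK {B : LinearMap.BilinForm k Λ} (hB : IsSymmetrizingForm B) (r : ℕ) :
    HK0 k Λ p r = idealK k Λ p r := by
  have : FiniteDimensional k Λᵐᵒᵖ := Module.Finite.equiv (MulOpposite.opLinearEquiv k)
  ext a
  constructor
  · rintro ⟨ha, h⟩
    refine ⟨ha, fun b hb => ?_⟩
    have h1 := op_mul_mem_commutatorSpace_of_characteristicZero_mem p ⟨a, ha⟩ r h
      (MulOpposite.op b) (op_mem_commutatorSpace hb)
    rw [(Subalgebra.mem_center_iff.1 ha b).symm]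
    exact unop_mem_commutatorSpace h1
  · rintro ⟨ha, h⟩
    refine ⟨ha, ?_⟩
    have hz := op_mem_center ⟨a, ha⟩
    refine mk₀_mem_kuelshammerIdeal (perfectTrace k Λᵐᵒᵖ) hB.opForm.traceForm
      (eq_zero_of_traceForm_perfectTrace hB.opForm) p (frob k Λᵐᵒᵖ p) (perfectTrace_tr_pow k p)
      (centerMulPerfect ⟨a, ha⟩) (characteristicZero_mem_gradedCenter _) (centerAct k _ hz)
      (perfectTrace_comp_centerMulPerfect ⟨a, ha⟩) r fun w hw => ?_
    -- For a class w of b, vanishing under r Frobenius steps means that b^(p^r) is in the commutator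
    -- space, so the hypothesis on a gives the required vanishing.
    obtain ⟨b, rfl⟩ := Submodule.Quotient.mk_surjective _ w
    have hb : b ^ p ^ r ∈ commutatorSpace k Λᵐᵒᵖ :=
      (Submodule.Quotient.mk_eq_zero _).1 ((iterate_frob_cls k p r b).symm.trans hw)
    have h1 := op_mem_commutatorSpace (h b.unop (unop_mem_commutatorSpace hb))
    rw [(Subalgebra.mem_center_iff.1 ha b.unop).symm] at h1
    rw [centerAct_cls]
    exact (congrArg _ ((Submodule.Quotient.mk_eq_zero _).2 h1)).trans (map_zero _)

theorem HR0_eq_idealR {B : LinearMap.BilinForm k Λ} (hB : IsSymmetrizingForm B) :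
    HR0 k Λ p = idealR k Λ p := by
  ext a
  simp only [idealR, Set.mem_iInter, ← HK0_eq_idealK p hB]
  constructor
  · rintro ⟨ha, h⟩ r
    exact ⟨ha, Set.mem_iInter.1 h r⟩
  · intro h
    obtain ⟨ha, -⟩ := h 0
    exact ⟨ha, Set.mem_iInter.2 fun r => (h r).2⟩

end Main

end Kuelshammer

theorem mainTheorem10 {k : Type*} [Field k] (p : ℕ) [Fact p.Prime] [CharP k p]
    {Λ : Type*} [Ring Λ] [Algebra k Λ] [FiniteDimensional k Λ]
    (B : LinearMap.BilinForm k Λ) (hB : Kuelshammer.IsSymmetrizingForm B) :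
    (∀ r : ℕ, Kuelshammer.HK0 k Λ p r = Kuelshammer.idealK k Λ p r ∧
      Kuelshammer.idealK k Λ p r = Kuelshammer.idealKcl B p r) ∧
    Kuelshammer.HR0 k Λ p = Kuelshammer.idealR k Λ p ∧
    Kuelshammer.idealR k Λ p =
      (Subalgebra.center k Λ : Set Λ) ∩ (Kuelshammer.socle Λ Λ : Set Λ) ∧
    Kuelshammer.idealR k Λ p =
      (Subalgebra.center k Λ : Set Λ) ∩ (Kuelshammer.socle Λᵐᵒᵖ Λ : Set Λ) :=
  ⟨fun r => ⟨Kuelshammer.HK0_eq_idealK p hB r, Kuelshammer.idealK_eq_idealKcl hB p r⟩,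
    Kuelshammer.HR0_eq_idealR p hB, Kuelshammer.idealR_eq_center_inter_socle p hB,
    Kuelshammer.idealR_eq_center_inter_socle_op p hB⟩
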